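/- Let $\alpha>0$, $\alpha\neq1$, and let $\mu$ be a $\sigma$-finite measure on a measurable space $\mathbb X$. All probability measures $P,Q,R$ below are assumed absolutely continuous with respect to $\mu$, with densities $p,q,r\in L^\alpha(\mu)$ (that is, $\int p^\alpha\,d\mu<\infty$, etc.). With $\rho=\alpha^{-1}-1$, $f(u)=\operatorname{sgn}(\rho)(u^{1+\rho}-1)$ and escort densities $p'=p^\alpha/\int p^\alpha d\mu$, $q'=q^\alpha/\int q^\alpha d\mu$, the relative $\alpha$-entropy is $$\mathscr I_\alpha(P,Q)=\frac1\rho\log\Big[\operatorname{sgn}(\rho)\int q' f(p'/q')\,d\mu+1\Big]\in[0,\infty],$$ where $0f(0/0)=0$ and, for $a>0$, $0f(a/0)=\infty$ if $\rho>0$ and $0f(a/0)=0$ if $\rho<0$. A forward $\mathscr I_\alpha$-projection of $R$ on a set $\mathbb E$ of probability measures containing some $P$ with $\mathscr I_\alpha(P,R)<\infty$ is a $Q\in\mathbb E$ with $\mathscr I_\alpha(Q,R)=\inf_{P\in\mathbb E}\mathscr I_\alpha(P,R)$. Let $f_\gamma:\mathbb X\to\mathbb R$ ($\gamma\in\Gamma$,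 an arbitrary index set) be measurable functions, let $\mathbb L=\{P:\ f_\gamma\in L^1(P),\ \int f_\gamma\,dP=0\ \text{for all }\gamma\in\Gamma\}$, and let $R$ have density $r$. For $Q\in\mathbb L$, a real number $c$, a function $g:\mathbb X\to\mathbb R$ and a measurable set $N\subseteq\mathbb X$, consider the conditions, where powers are taken in $[0,\infty]$ (so $0^{\alpha-1}=\infty$ if $\alpha<1$): 1. for $\mu$-almost every $x$: $q(x)^{\alpha-1}=c\,r(x)^{\alpha-1}+g(x)$ if $x\notin N$, and $q(x)=0$ if $x\in N$; 2. for every $P\in\mathbb L$ with $\mathscr I_\alpha(P,R)<\infty$: if $\alpha<1$, then $P(N)=0$; if $\alpha>1$, then $g$ is $P$-integrable on $\mathbb X\setminus N$ and $c\int_N r^{\alpha-1}\,dP\le\int_{\mathbb X\setminus N}g\,dP$. (a) If $Q$ is a forward $\mathscr I_\alpha$-projection of $R$ on $\mathbb L$, then there are $c$, $g$, $N$ satisfying 1 and 2 such that $0<\int q\,r^{\alpha-1}\,d\mu<\infty$, $$c=\frac{\int q^\alpha\,d\mu}{\int q\,r^{\alpha-1}\,d\mu},$$ and $g$ belongs to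 the $L^1(Q)$-closure of the linear span of $\{f_\gamma\}_{\gamma\in\Gamma}$. (b) Conversely, if $Q\in\mathbb L$ satisfies 1 and 2 for some real $c$, some $g$ in the linear span of $\{f_\gamma\}_{\gamma\in\Gamma}$ and some measurable $N$, then $Q$ is the unique forward $\mathscr I_\alpha$-projection of $R$ on $\mathbb L$, and for every $P\in\mathbb L$ with $\mathscr I_\alpha(P,R)<\infty$, $$\mathscr I_\alpha(P,R)\ \ge\ \mathscr I_\alpha(P,Q)+\mathscr I_\alpha(Q,R),$$ with equality when $\alpha<1$. -/

import Mathlib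

open MeasureTheory
open scoped ENNReal

noncomputable section

namespace RelAlpha

variable {X : Type*} [MeasurableSpace X]

/-- The standing assumptions on a measure: it is a probability measure, dominated by `μ`, whose
`μ`-density belongs to `L^α(μ)`. -/
structure IsAdmissible (α : ℝ) (μ P : Measure X) : Prop where
  isProb : IsProbabilityMeasure P
  absCont : P ≪ μ
  memLalpha : ∫⁻ x, (P.rnDeriv μ x) ^ α ∂μ < ⊤

/-- The density `p' = p ^ α / ∫ p ^ α dμ` of the escort measure. -/
def escort (α : ℝ) (μ P : Measure X) (x : X) : ℝ≥0∞ :=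
  (P.rnDeriv μ x) ^ α / ∫⁻ y, (P.rnDeriv μ y) ^ α ∂μ

/-- `f(u) = sgn(ρ) (u ^ (1 + ρ) - 1)`. -/
def fFun (ρ u : ℝ) : ℝ := Real.sign ρ * (u ^ (1 + ρ) - 1)

/-- The integrand `b f(a / b)`, with `0 f(0 / 0) = 0` and, for `a > 0`,
`0 f(a / 0) = ∞` if `ρ > 0` and `0 f(a / 0) = 0` if `ρ < 0`. -/
def fDivIntegrand (ρ : ℝ) (a b : ℝ≥0∞) : EReal :=
  if b = 0 then (if a = 0 then 0 else if 0 < ρ then ⊤ else 0)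
  else ((b.toReal * fFun ρ (a.toReal / b.toReal) : ℝ) : EReal)

/-- The `f`-divergence `∫ q f(p / q) dμ` of two densities, as an extended real: the integral of
the positive part minus the integral of the negative part (the latter is finite for all
probability densities). -/
def fDiv (ρ : ℝ) (μ : Measure X) (p q : X → ℝ≥0∞) : EReal :=
  ((∫⁻ x, (fDivIntegrand ρ (p x) (q x)).toENNReal ∂μ : ℝ≥0∞) : EReal)
    - ((∫⁻ x, (-fDivIntegrand ρ (p x) (q x)).toENNReal ∂μ : ℝ≥0∞) : EReal)

/-- The relative `α`-entropy `(1 / ρ) log (sgn(ρ) I_f(P', Q') + 1)` with `ρ = 1 / α - 1`,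
where `log 0 = -∞` and `log ∞ = ∞`. -/
def relEntropy (α : ℝ) (μ P Q : Measure X) : EReal :=
  (((α⁻¹ - 1)⁻¹ : ℝ) : EReal) *
    ENNReal.log
      (((Real.sign (α⁻¹ - 1) : ℝ) : EReal) * fDiv (α⁻¹ - 1) μ (escort α μ P) (escort α μ Q)
        + 1).toENNReal

/-- `Q` is a forward projection of `R` on the set `E` of measures. -/
structure IsForwardProjection (α : ℝ) (μ : Measure X) (E : Set (Measure X)) (R Q : Measure X) :
    Prop where
  exists_finite : ∃ P ∈ E, relEntropy α μ P R < ⊤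
  mem : Q ∈ E
  eq_iInf : relEntropy α μ Q R = ⨅ P ∈ E, relEntropy α μ P R

/-- The linear family `{P : ∫ f_γ dP = 0 for all γ}` of (admissible) probability measures. -/
def linearFamily {Γ : Type*} (α : ℝ) (μ : Measure X) (f : Γ → X → ℝ) : Set (Measure X) :=
  {P | IsAdmissible α μ P ∧ ∀ γ, Integrable (f γ) P ∧ ∫ x, f γ x ∂P = 0}

/-- The power-law form: `q ^ (α - 1) = c r ^ (α - 1) + g` off `N` and `q = 0` on `N`, for
`μ`-almost every point since densities are only defined up to null sets. Both powers are taken in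
`[0, ∞]`, so that `0 ^ (α - 1) = ∞` if `α < 1`. -/
def HasPowerLawForm (α : ℝ) (μ Q R : Measure X) (c : ℝ) (g : X → ℝ) (N : Set X) : Prop :=
  ∀ᵐ x ∂μ,
    (x ∉ N → (((Q.rnDeriv μ x) ^ (α - 1) : ℝ≥0∞) : EReal)
      = (c : EReal) * (((R.rnDeriv μ x) ^ (α - 1) : ℝ≥0∞) : EReal) + (g x : EReal)) ∧
    (x ∈ N → Q.rnDeriv μ x = 0)

/-- The side condition on `N`: for every `P` in `E` at finite relative `α`-entropy from `R`,
`P(N) = 0` if `α < 1`, and `c ∫_N r ^ (α - 1) dP ≤ ∫_{X \ N} g dP` if `α > 1` (the last integral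
being well defined and finite). -/
def SideCondition (α : ℝ) (μ : Measure X) (E : Set (Measure X)) (R : Measure X)
    (c : ℝ) (g : X → ℝ) (N : Set X) : Prop :=
  ∀ P ∈ E, relEntropy α μ P R < ⊤ →
    (α < 1 → P N = 0) ∧
    (1 < α → IntegrableOn g Nᶜ P ∧
      (c : EReal) * ((∫⁻ x in N, (R.rnDeriv μ x) ^ (α - 1) ∂P : ℝ≥0∞) : EReal)
        ≤ ((∫ x in Nᶜ, g x ∂P : ℝ) : EReal))

/-- `g` belongs to the `L¹(Q)`-closure of the linear span of the functions `f γ`. -/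
def InL1ClosureSpan {Γ : Type*} (Q : Measure X) (f : Γ → X → ℝ) (g : X → ℝ) : Prop :=
  MemLp g 1 Q ∧
    ∀ ε : ℝ≥0∞, 0 < ε → ∃ h ∈ Submodule.span ℝ (Set.range f), eLpNorm (g - h) 1 Q < ε

end RelAlpha

end

/-! Write A(u,v) = ∫ u v^(α-1) dμ and ‖u‖ = (∫ u^α dμ)^(1/α). On escort densities the f-divergence
collapses, so that I_α(P,Q) = ρ⁻¹ log N(p,q) with N(u,v) = A(u,v) / (‖u‖ ‖v‖^(α-1))
(`relEntropy_eq_log`). For α > 1, Hölder gives N ≤ 1; for α < 1 its reverse gives N ≥ 1. Between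
probability densities equality holds only when they coincide. A projection of R therefore minimizes
A(p,r)/‖p‖ if α < 1 and maximizes it if α > 1, and the numerator is linear in p.

Converse (b): integrating the power law against Q gives ‖q‖^α = c A(q,r), because g has Q-mean zero.
Integrating it against P gives A(p,q) = c A(p,r) if α < 1, and ≥ if α > 1, where the side condition
pays for the part on N. The norms of q then cancel in N(p,q) N(q,r), which compares with N(p,r):
this is the Pythagorean relation (`pythagorean_of_hasPowerLawForm`). Minimality follows from
nonnegativity of I_α, uniqueness from its equality case.

Direct part (a): the family is convex, so Q may be compared with sQ + tP. Without differentiating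
the norm, Hölder and the limit t → 0 give A(q,r) A(p,q) ≤ ‖q‖^α A(p,r) for α < 1, and the reverse
for α > 1. In terms of g = q^(α-1) - c r^(α-1), ∫ g dP has a fixed sign whenever P has finite
entropy, while ∫ g dQ = 0. With N = {q = 0} this yields the side condition. Taking P proportional to
(1 ± δk) Q, with k bounded and annihilating every f_γ, forces ∫ k g dQ = 0; Hahn-Banach and the
duality of L¹ with L^∞ then place g in the closed span. -/

open Filter
open scoped Topology

namespace RelAlpha

/-! ### Pointwise form of the integrand and weighted AM-GM in `ℝ≥0∞` -/

section

/-- Positive and negative parts of the integrand for `ρ > 0`. -/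
lemma toENNReal_fDivIntegrand_of_pos {ρ : ℝ} (hρ : 0 < ρ) {a b : ℝ≥0∞} (ha : a ≠ ⊤) (hb : b ≠ ⊤) :
    (fDivIntegrand ρ a b).toENNReal = a ^ (1 + ρ) * b ^ (-ρ) - b ∧
      (-fDivIntegrand ρ a b).toENNReal = b - a ^ (1 + ρ) * b ^ (-ρ) := by
  have h1 : 0 < 1 + ρ := by linarith
  unfold fDivIntegrand
  by_cases hb0 : b = 0
  · subst hb0
    by_cases ha0 : a = 0
    · simp [ha0, h1]
    · have h2 : a ^ (1 + ρ) ≠ 0 := by simp [ha0, ha]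
      simp [ha0, hρ, ENNReal.zero_rpow_of_neg (neg_lt_zero.2 hρ), ENNReal.mul_top h2]
  · lift a to NNReal using ha
    lift b to NNReal using hb
    have hb0' : b ≠ 0 := by simpa using hb0
    have hbp : (0 : ℝ) < b := by positivity
    have key : (b : ℝ) * fFun ρ (a / b) = (a : ℝ) ^ (1 + ρ) * (b : ℝ) ^ (-ρ) - b := by
      unfold fFun
      rw [Real.sign_of_pos hρ, Real.div_rpow a.coe_nonneg b.coe_nonneg, Real.rpow_add hbp, Real.rpow_neg b.coe_nonneg,
        Real.rpow_one]
      field_simp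
    have hk : ((a : ℝ≥0∞) ^ (1 + ρ) * (b : ℝ≥0∞) ^ (-ρ)) =
        ENNReal.ofReal ((a : ℝ) ^ (1 + ρ) * (b : ℝ) ^ (-ρ)) := by
      rw [← ENNReal.coe_rpow_of_nonneg _ h1.le, ← ENNReal.coe_rpow_of_ne_zero hb0',
        ← ENNReal.coe_mul, ← ENNReal.ofReal_coe_nnreal]
      simp
    rw [if_neg hb0, hk]
    simp only [ENNReal.coe_toReal, key]
    rw [← EReal.coe_neg, EReal.toENNReal_of_ne_top (EReal.coe_ne_top _),
      EReal.toENNReal_of_ne_top (EReal.coe_ne_top _), EReal.toReal_coe, EReal.toReal_coe, neg_sub,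
      ENNReal.ofReal_sub _ hbp.le, ENNReal.ofReal_sub _ (by positivity), ENNReal.ofReal_coe_nnreal]
    exact ⟨rfl, rfl⟩

/-- Positive and negative parts of the integrand for `-1 < ρ < 0`. -/
lemma toENNReal_fDivIntegrand_of_neg {ρ : ℝ} (hρ : ρ < 0) (h1 : 0 < 1 + ρ) {a b : ℝ≥0∞}
    (ha : a ≠ ⊤) (hb : b ≠ ⊤) :
    (fDivIntegrand ρ a b).toENNReal = b - a ^ (1 + ρ) * b ^ (-ρ) ∧
      (-fDivIntegrand ρ a b).toENNReal = a ^ (1 + ρ) * b ^ (-ρ) - b := by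
  unfold fDivIntegrand
  by_cases hb0 : b = 0
  · subst hb0
    simp [hρ, hρ.not_gt]
  · lift a to NNReal using ha
    lift b to NNReal using hb
    have hb0' : b ≠ 0 := by simpa using hb0
    have hbp : (0 : ℝ) < b := by positivity
    have key : (b : ℝ) * fFun ρ (a / b) = b - (a : ℝ) ^ (1 + ρ) * (b : ℝ) ^ (-ρ) := by
      unfold fFun
      rw [Real.sign_of_neg hρ, Real.div_rpow a.coe_nonneg b.coe_nonneg, Real.rpow_add hbp, Real.rpow_neg b.coe_nonneg,
        Real.rpow_one]
      field_simp
      ring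
    have hk : ((a : ℝ≥0∞) ^ (1 + ρ) * (b : ℝ≥0∞) ^ (-ρ)) =
        ENNReal.ofReal ((a : ℝ) ^ (1 + ρ) * (b : ℝ) ^ (-ρ)) := by
      rw [← ENNReal.coe_rpow_of_nonneg _ h1.le, ← ENNReal.coe_rpow_of_ne_zero hb0',
        ← ENNReal.coe_mul, ← ENNReal.ofReal_coe_nnreal]
      simp
    rw [if_neg hb0, hk]
    simp only [ENNReal.coe_toReal, key]
    rw [← EReal.coe_neg, EReal.toENNReal_of_ne_top (EReal.coe_ne_top _),
      EReal.toENNReal_of_ne_top (EReal.coe_ne_top _), EReal.toReal_coe, EReal.toReal_coe, neg_sub,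
      ENNReal.ofReal_sub _ hbp.le, ENNReal.ofReal_sub _ (by positivity), ENNReal.ofReal_coe_nnreal]
    exact ⟨rfl, rfl⟩

/-- Strict weighted AM-GM inequality in `ℝ≥0∞`. -/
lemma rpow_mul_rpow_lt {θ : ℝ} (h0 : 0 < θ) (h1 : θ < 1) {a b : ℝ≥0∞} (ha : a ≠ ⊤) (hb : b ≠ ⊤)
    (hab : a ≠ b) :
    a ^ θ * b ^ (1 - θ) < ENNReal.ofReal θ * a + ENNReal.ofReal (1 - θ) * b := by
  lift a to NNReal using ha
  lift b to NNReal using hb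
  have hab' : (a : ℝ) ≠ b := by simpa using hab
  have h1' : 0 < 1 - θ := by linarith
  have key : (a : ℝ) ^ θ * (b : ℝ) ^ (1 - θ) < θ * a + (1 - θ) * b := by
    rcases a.2.eq_or_lt with ha | ha
    · have ha : (a : ℝ) = 0 := ha.symm
      have : (0 : ℝ) < b := lt_of_le_of_ne b.coe_nonneg (ha ▸ hab')
      rw [ha, Real.zero_rpow h0.ne']
      nlinarith [mul_pos h1' this]
    rcases b.2.eq_or_lt with hb | hb
    · have hb : (b : ℝ) = 0 := hb.symm
      rw [hb, Real.zero_rpow h1'.ne']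
      nlinarith [mul_pos h0 (show (0 : ℝ) < a from ha)]
    have ha : (0 : ℝ) < a := ha
    have hb : (0 : ℝ) < b := hb
    have := strictConcaveOn_log_Ioi.2 ha hb hab' h0 h1' (by ring)
    simp only [smul_eq_mul] at this
    have hp : 0 < θ * (a : ℝ) + (1 - θ) * b := by positivity
    rw [← Real.log_lt_log_iff (by positivity) hp, Real.log_mul (by positivity) (by positivity),
      Real.log_rpow ha, Real.log_rpow hb]
    exact this
  have hk : ((a : ℝ≥0∞) ^ θ * (b : ℝ≥0∞) ^ (1 - θ)) =
      ENNReal.ofReal ((a : ℝ) ^ θ * (b : ℝ) ^ (1 - θ)) := by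
    rw [← ENNReal.coe_rpow_of_nonneg _ h0.le, ← ENNReal.coe_rpow_of_nonneg _ h1'.le,
      ← ENNReal.coe_mul, ← ENNReal.ofReal_coe_nnreal]
    simp
  have hs : ENNReal.ofReal θ * (a : ℝ≥0∞) + ENNReal.ofReal (1 - θ) * b =
      ENNReal.ofReal (θ * a + (1 - θ) * b) := by
    rw [ENNReal.ofReal_add (by positivity) (by positivity), ENNReal.ofReal_mul h0.le,
      ENNReal.ofReal_mul h1'.le, ENNReal.ofReal_coe_nnreal, ENNReal.ofReal_coe_nnreal]
  rw [hk, hs, ENNReal.ofReal_lt_ofReal_iff_of_nonneg (by positivity)]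
  exact key

/-- The reversed strict inequality for an exponent greater than one. -/
lemma lt_rpow_mul_rpow {θ : ℝ} (h1 : 1 < θ) {a b : ℝ≥0∞} (ha : a ≠ ⊤) (hb : b ≠ ⊤)
    (hab : a ≠ b) :
    ENNReal.ofReal θ * a < a ^ θ * b ^ (1 - θ) + ENNReal.ofReal (θ - 1) * b := by
  have h0 : 0 < θ := by linarith
  by_cases hb0 : b = 0
  · subst hb0
    have h2 : a ^ θ ≠ 0 := by simp [ha, hab]
    rw [ENNReal.zero_rpow_of_neg (by linarith), ENNReal.mul_top h2, top_add]
    exact (ENNReal.mul_ne_top ENNReal.ofReal_ne_top ha).lt_top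
  -- Since a = k^(1/θ) b^(1-1/θ), this is AM-GM with weight 1/θ for the pair (k, b), multiplied by
  -- θ.
  obtain ⟨k, hk⟩ : ∃ k, k = a ^ θ * b ^ (1 - θ) := ⟨_, rfl⟩
  rw [← hk]
  have hkt : k ≠ ⊤ := hk ▸ ENNReal.mul_ne_top (ENNReal.rpow_ne_top_of_nonneg h0.le ha)
    (ENNReal.rpow_ne_top_of_ne_zero hb0 hb)
  have hka : k ^ θ⁻¹ * b ^ (1 - θ⁻¹) = a := by
    rw [hk, ENNReal.mul_rpow_of_nonneg _ _ (by positivity), ← ENNReal.rpow_mul, ← ENNReal.rpow_mul,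
      mul_assoc, ← ENNReal.rpow_add _ _ hb0 hb, mul_inv_cancel₀ h0.ne', ENNReal.rpow_one]
    have : (1 - θ) * θ⁻¹ + (1 - θ⁻¹) = 0 := by field_simp; ring
    rw [this, ENNReal.rpow_zero, mul_one]
  have hkb : k ≠ b := by
    intro h
    apply hab
    rw [← hka, h, ← ENNReal.rpow_add _ _ hb0 hb]
    simp
  have := rpow_mul_rpow_lt (inv_pos.2 h0) (inv_lt_one_of_one_lt₀ h1) hkt hb hkb
  rw [hka] at this
  have h3 := ENNReal.mul_lt_mul_right (a := ENNReal.ofReal θ) (by simpa using h0)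
    ENNReal.ofReal_ne_top this
  rwa [mul_add, ← mul_assoc, ← mul_assoc, ← ENNReal.ofReal_mul h0.le, ← ENNReal.ofReal_mul h0.le,
    mul_inv_cancel₀ h0.ne', ENNReal.ofReal_one, one_mul,
    show θ * (1 - θ⁻¹) = θ - 1 by field_simp] at h3

/-- The exponents sum to 1 > 0, so a = 0 is harmless even when one exponent is negative: 0 · ∞ = 0.
-/
lemma rpow_mul_rpow_self {θ : ℝ} {a : ℝ≥0∞} (ha : a ≠ ⊤) : a ^ θ * a ^ (1 - θ) = a := by
  rw [← ENNReal.rpow_add_of_add_pos ha _ _ (by linarith)]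
  simp

end

/-! ### Cross integrals of escort densities and the two Hölder inequalities -/

section

variable {X : Type*} [MeasurableSpace X]

/-- `∫ u ^ α dμ`. -/
noncomputable def powerIntegral (α : ℝ) (μ : Measure X) (u : X → ℝ≥0∞) : ℝ≥0∞ :=
  ∫⁻ x, u x ^ α ∂μ

/-- `∫ u v ^ (α - 1) dμ`. -/
noncomputable def crossIntegral (α : ℝ) (μ : Measure X) (u v : X → ℝ≥0∞) : ℝ≥0∞ :=
  ∫⁻ x, u x * v x ^ (α - 1) ∂μ

/-- `∫ (u / ‖u‖) (v / ‖v‖) ^ (α - 1) dμ`, with `‖u‖ ^ α = ∫ u ^ α dμ`. -/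
noncomputable def normalizedCross (α : ℝ) (μ : Measure X) (u v : X → ℝ≥0∞) : ℝ≥0∞ :=
  crossIntegral α μ u v *
    ((powerIntegral α μ u ^ α⁻¹)⁻¹ * (powerIntegral α μ v ^ (1 - α⁻¹))⁻¹)

lemma coe_sub_coe_add_one {s t k : ℝ≥0∞} (hs : s ≠ ⊤) (h : t + 1 = s + k) :
    (t : EReal) - (s : EReal) + 1 = (k : EReal) := by
  lift s to NNReal using hs
  by_cases ht : t = ⊤
  · have hk : k = ⊤ := by
      by_contra hk
      rw [ht, top_add] at h
      exact ENNReal.add_ne_top.2 ⟨ENNReal.coe_ne_top, hk⟩ h.symm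
    rw [ht, hk]
    exact EReal.top_add_coe 1
  · have hk : k ≠ ⊤ := by
      rintro rfl
      exact ENNReal.add_ne_top.2 ⟨ht, ENNReal.one_ne_top⟩ (by simpa using h)
    lift t to NNReal using ht
    lift k to NNReal using hk
    have : (t : ℝ) + 1 = s + k := by exact_mod_cast h
    have h3 : (k : ℝ) = t - s + 1 := by linarith
    change ((t : ℝ) : EReal) - ((s : ℝ) : EReal) + ((1 : ℝ) : EReal) = ((k : ℝ) : EReal)
    rw [h3]
    norm_cast

/-- The two parts of the integrand are the truncated differences of k = a^(1+ρ) b^(-ρ) and b. Since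
∫ b = 1, the divergence is sgn(ρ)(∫ k - 1). The part ∫ (b - k)⁺ is at most 1, so no ∞ - ∞ occurs
even if ∫ k = ∞. -/
lemma sign_mul_fDiv_add_one {ρ : ℝ} (hρ : ρ ≠ 0) (h1 : 0 < 1 + ρ) {μ : Measure X}
    {a b : X → ℝ≥0∞} (ham : Measurable a) (hbm : Measurable b) (ha : ∀ᵐ x ∂μ, a x ≠ ⊤)
    (hb : ∫⁻ x, b x ∂μ = 1) :
    ((Real.sign ρ : ℝ) : EReal) * fDiv ρ μ a b + 1 =
      ((∫⁻ x, a x ^ (1 + ρ) * b x ^ (-ρ) ∂μ : ℝ≥0∞) : EReal) := by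
  have hbt : ∀ᵐ x ∂μ, b x ≠ ⊤ := by
    filter_upwards [ae_lt_top hbm (by simp [hb])] with x hx using hx.ne
  have hkm : Measurable fun x => a x ^ (1 + ρ) * b x ^ (-ρ) := by fun_prop
  have hsum : ∫⁻ x, a x ^ (1 + ρ) * b x ^ (-ρ) - b x ∂μ + 1 =
      ∫⁻ x, b x - a x ^ (1 + ρ) * b x ^ (-ρ) ∂μ + ∫⁻ x, a x ^ (1 + ρ) * b x ^ (-ρ) ∂μ := by
    rw [← hb, ← lintegral_add_right _ hbm, ← lintegral_add_right _ hkm]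
    refine lintegral_congr fun x => ?_
    rw [tsub_add_eq_max, tsub_add_eq_max, max_comm]
  have hfin : ∫⁻ x, b x - a x ^ (1 + ρ) * b x ^ (-ρ) ∂μ ≠ ⊤ := by
    refine ne_top_of_le_ne_top ENNReal.one_ne_top (hb ▸ lintegral_mono fun x => tsub_le_self)
  unfold fDiv
  rcases hρ.lt_or_gt with hneg | hpos
  · rw [lintegral_congr_ae (g := fun x => b x - a x ^ (1 + ρ) * b x ^ (-ρ)),
      lintegral_congr_ae (f := fun x => (-fDivIntegrand ρ (a x) (b x)).toENNReal)
      (g := fun x => a x ^ (1 + ρ) * b x ^ (-ρ) - b x)]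
    · rw [Real.sign_of_neg hneg]
      generalize ∫⁻ x, b x - a x ^ (1 + ρ) * b x ^ (-ρ) ∂μ = s at *
      generalize ∫⁻ x, a x ^ (1 + ρ) * b x ^ (-ρ) - b x ∂μ = t at *
      generalize ∫⁻ x, a x ^ (1 + ρ) * b x ^ (-ρ) ∂μ = k at *
      rw [← coe_sub_coe_add_one hfin hsum, EReal.coe_neg, EReal.coe_one, neg_one_mul,
        EReal.neg_sub (by simp) (by simp [hfin]), add_comm (-(s : EReal)), ← sub_eq_add_neg]
    · filter_upwards [ha, hbt] with x h1x h2x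
        using (toENNReal_fDivIntegrand_of_neg hneg h1 h1x h2x).2
    · filter_upwards [ha, hbt] with x h1x h2x
        using (toENNReal_fDivIntegrand_of_neg hneg h1 h1x h2x).1
  · rw [lintegral_congr_ae (g := fun x => a x ^ (1 + ρ) * b x ^ (-ρ) - b x),
      lintegral_congr_ae (f := fun x => (-fDivIntegrand ρ (a x) (b x)).toENNReal)
      (g := fun x => b x - a x ^ (1 + ρ) * b x ^ (-ρ))]
    · rw [Real.sign_of_pos hpos]
      generalize ∫⁻ x, b x - a x ^ (1 + ρ) * b x ^ (-ρ) ∂μ = s at *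
      generalize ∫⁻ x, a x ^ (1 + ρ) * b x ^ (-ρ) - b x ∂μ = t at *
      generalize ∫⁻ x, a x ^ (1 + ρ) * b x ^ (-ρ) ∂μ = k at *
      rw [← coe_sub_coe_add_one hfin hsum, EReal.coe_one, one_mul]
    · filter_upwards [ha, hbt] with x h1x h2x
        using (toENNReal_fDivIntegrand_of_pos hpos h1x h2x).2
    · filter_upwards [ha, hbt] with x h1x h2x
        using (toENNReal_fDivIntegrand_of_pos hpos h1x h2x).1

/-- For negative exponents multiplicativity breaks only at 0 · ∞. Controlling the normalizing
constant `y` suffices, so the density `x` may vanish. -/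
lemma mul_rpow_of_ne_zero_of_ne_top (x : ℝ≥0∞) {y : ℝ≥0∞} (hy : y ≠ 0) (hy' : y ≠ ⊤) (z : ℝ) :
    (x * y) ^ z = x ^ z * y ^ z := by
  rw [ENNReal.mul_rpow_eq_ite, if_neg]
  simp [hy, hy']

variable {α : ℝ} {μ : Measure X} {u v : X → ℝ≥0∞}

lemma lintegral_escort_eq_one (hu0 : powerIntegral α μ u ≠ 0) (hu : powerIntegral α μ u ≠ ⊤) :
    ∫⁻ x, u x ^ α / powerIntegral α μ u ∂μ = 1 := by
  simp only [div_eq_mul_inv]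
  rw [lintegral_mul_const' _ _ (ENNReal.inv_ne_top.2 hu0)]
  exact ENNReal.mul_inv_cancel hu0 hu

/-- The geometric mean of two escort densities. -/
lemma escort_rpow_mul_escort_rpow (hα : 0 < α) (hu0 : powerIntegral α μ u ≠ 0)
    (hu : powerIntegral α μ u ≠ ⊤) (hv0 : powerIntegral α μ v ≠ 0)
    (hv : powerIntegral α μ v ≠ ⊤) (x : X) :
    (u x ^ α / powerIntegral α μ u) ^ α⁻¹ * (v x ^ α / powerIntegral α μ v) ^ (1 - α⁻¹) =
      u x * v x ^ (α - 1) *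
        ((powerIntegral α μ u ^ α⁻¹)⁻¹ * (powerIntegral α μ v ^ (1 - α⁻¹))⁻¹) := by
  rw [div_eq_mul_inv, div_eq_mul_inv,
    mul_rpow_of_ne_zero_of_ne_top _ (ENNReal.inv_ne_zero.2 hu) (ENNReal.inv_ne_top.2 hu0),
    mul_rpow_of_ne_zero_of_ne_top _ (ENNReal.inv_ne_zero.2 hv) (ENNReal.inv_ne_top.2 hv0),
    ENNReal.inv_rpow, ENNReal.inv_rpow, ENNReal.rpow_rpow_inv hα.ne', ← ENNReal.rpow_mul,
    show α * (1 - α⁻¹) = α - 1 by field_simp]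
  ring

lemma lintegral_escort_rpow_mul_escort_rpow (hα : 0 < α) (hu0 : powerIntegral α μ u ≠ 0)
    (hu : powerIntegral α μ u ≠ ⊤) (hv0 : powerIntegral α μ v ≠ 0)
    (hv : powerIntegral α μ v ≠ ⊤) :
    ∫⁻ x, (u x ^ α / powerIntegral α μ u) ^ α⁻¹ *
      (v x ^ α / powerIntegral α μ v) ^ (1 - α⁻¹) ∂μ = normalizedCross α μ u v := by
  simp only [escort_rpow_mul_escort_rpow hα hu0 hu hv0 hv]
  rw [lintegral_mul_const']
  · rfl
  · have h1 : powerIntegral α μ u ^ α⁻¹ ≠ 0 := by simp [hu0, hu]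
    have h2 : powerIntegral α μ v ^ (1 - α⁻¹) ≠ 0 := by simp [hv0, hv]
    exact ENNReal.mul_ne_top (ENNReal.inv_ne_top.2 h1) (ENNReal.inv_ne_top.2 h2)

lemma ae_ne_top_of_powerIntegral_ne_top (hα : 0 < α) (hum : Measurable u)
    (hu : powerIntegral α μ u ≠ ⊤) : ∀ᵐ x ∂μ, u x ≠ ⊤ := by
  filter_upwards [ae_lt_top (by fun_prop) hu] with x hx h
  rw [h, ENNReal.top_rpow_of_pos hα] at hx
  exact hx.ne rfl

lemma ae_escort_ne_top (hum : Measurable u) (hu0 : powerIntegral α μ u ≠ 0)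
    (hu : powerIntegral α μ u ≠ ⊤) : ∀ᵐ x ∂μ, u x ^ α / powerIntegral α μ u ≠ ⊤ := by
  filter_upwards [ae_lt_top (by fun_prop) hu] with x hx using ENNReal.div_ne_top hx.ne hu0

/-- Integrating the pointwise inequality gives θ ≤ ∫ a^θ b^(1-θ) + (θ - 1). Equality of the
integrals forces a.e. equality of the integrands, and strictness then leaves only a = b. -/
lemma one_le_lintegral_rpow_mul_rpow {θ : ℝ} (hθ : 1 < θ) {a b : X → ℝ≥0∞} (ham : Measurable a)
    (hbm : Measurable b) (ha : ∫⁻ x, a x ∂μ = 1) (hb : ∫⁻ x, b x ∂μ = 1) :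
    1 ≤ ∫⁻ x, a x ^ θ * b x ^ (1 - θ) ∂μ ∧
      (∫⁻ x, a x ^ θ * b x ^ (1 - θ) ∂μ = 1 → a =ᵐ[μ] b) := by
  have hat := ae_lt_top (μ := μ) ham (by simp [ha])
  have hbt := ae_lt_top (μ := μ) hbm (by simp [hb])
  have hle : (fun x => ENNReal.ofReal θ * a x) ≤ᵐ[μ]
      fun x => a x ^ θ * b x ^ (1 - θ) + ENNReal.ofReal (θ - 1) * b x := by
    filter_upwards [hat, hbt] with x h1 h2
    by_cases h : a x = b x
    · rw [h, rpow_mul_rpow_self h2.ne]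
      nth_rewrite 2 [← one_mul (b x)]
      rw [← ENNReal.ofReal_one, ← add_mul, ← ENNReal.ofReal_add zero_le_one (by linarith)]
      simp
    · exact (lt_rpow_mul_rpow hθ h1.ne h2.ne h).le
  have hI1 : ∫⁻ x, ENNReal.ofReal θ * a x ∂μ = ENNReal.ofReal (θ - 1) + 1 := by
    rw [lintegral_const_mul _ ham, ha, mul_one, ← ENNReal.ofReal_one,
      ← ENNReal.ofReal_add (by linarith) zero_le_one, sub_add_cancel]
  have hI2 : ∫⁻ x, (a x ^ θ * b x ^ (1 - θ) + ENNReal.ofReal (θ - 1) * b x) ∂μ =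
      ENNReal.ofReal (θ - 1) + ∫⁻ x, a x ^ θ * b x ^ (1 - θ) ∂μ := by
    rw [lintegral_add_right _ (by fun_prop), lintegral_const_mul _ hbm, hb, mul_one, add_comm]
  refine ⟨?_, fun h => ?_⟩
  · have := lintegral_mono_ae hle
    rw [hI1, hI2] at this
    exact (ENNReal.add_le_add_iff_left ENNReal.ofReal_ne_top).1 this
  · have := ae_eq_of_ae_le_of_lintegral_le hle (by rw [hI1]; finiteness) (by fun_prop)
      (by rw [hI1, hI2, h])
    filter_upwards [this, hat, hbt] with x hx h1 h2
    by_contra hne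
    exact (lt_rpow_mul_rpow hθ h1.ne h2.ne hne).ne hx

lemma lintegral_rpow_mul_rpow_le_one {θ : ℝ} (h0 : 0 < θ) (hθ : θ < 1) {a b : X → ℝ≥0∞}
    (ham : Measurable a) (hbm : Measurable b) (ha : ∫⁻ x, a x ∂μ = 1) (hb : ∫⁻ x, b x ∂μ = 1) :
    ∫⁻ x, a x ^ θ * b x ^ (1 - θ) ∂μ ≤ 1 ∧
      (∫⁻ x, a x ^ θ * b x ^ (1 - θ) ∂μ = 1 → a =ᵐ[μ] b) := by
  have hat := ae_lt_top (μ := μ) ham (by simp [ha])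
  have hbt := ae_lt_top (μ := μ) hbm (by simp [hb])
  have hle : (fun x => a x ^ θ * b x ^ (1 - θ)) ≤ᵐ[μ]
      fun x => ENNReal.ofReal θ * a x + ENNReal.ofReal (1 - θ) * b x := by
    filter_upwards [hat, hbt] with x h1 h2
    by_cases h : a x = b x
    · rw [h, rpow_mul_rpow_self h2.ne, ← add_mul, ← ENNReal.ofReal_add h0.le (by linarith)]
      simp
    · exact (rpow_mul_rpow_lt h0 hθ h1.ne h2.ne h).le
  have hI : ∫⁻ x, (ENNReal.ofReal θ * a x + ENNReal.ofReal (1 - θ) * b x) ∂μ = 1 := by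
    rw [lintegral_add_right _ (by fun_prop), lintegral_const_mul _ hbm, lintegral_const_mul _ ham,
      ha, hb, mul_one, mul_one, ← ENNReal.ofReal_add h0.le (by linarith)]
    simp
  refine ⟨?_, fun h => ?_⟩
  · have := lintegral_mono_ae hle
    rwa [hI] at this
  · have := ae_eq_of_ae_le_of_lintegral_le hle (by simp [h]) (by fun_prop) (by rw [hI, h])
    filter_upwards [this, hat, hbt] with x hx h1 h2
    by_contra hne
    exact (rpow_mul_rpow_lt h0 hθ h1.ne h2.ne hne).ne hx

lemma one_le_normalizedCross (hα : 0 < α) (hα1 : α < 1) (hum : Measurable u)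
    (hvm : Measurable v) (hu0 : powerIntegral α μ u ≠ 0) (hu : powerIntegral α μ u ≠ ⊤)
    (hv0 : powerIntegral α μ v ≠ 0) (hv : powerIntegral α μ v ≠ ⊤) :
    1 ≤ normalizedCross α μ u v := by
  rw [← lintegral_escort_rpow_mul_escort_rpow hα hu0 hu hv0 hv]
  exact (one_le_lintegral_rpow_mul_rpow ((one_lt_inv₀ hα).2 hα1) (by fun_prop) (by fun_prop)
    (lintegral_escort_eq_one hu0 hu) (lintegral_escort_eq_one hv0 hv)).1

lemma normalizedCross_le_one (hα1 : 1 < α) (hum : Measurable u)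
    (hvm : Measurable v) (hu0 : powerIntegral α μ u ≠ 0) (hu : powerIntegral α μ u ≠ ⊤)
    (hv0 : powerIntegral α μ v ≠ 0) (hv : powerIntegral α μ v ≠ ⊤) :
    normalizedCross α μ u v ≤ 1 := by
  have hα : 0 < α := by linarith
  rw [← lintegral_escort_rpow_mul_escort_rpow hα hu0 hu hv0 hv]
  exact (lintegral_rpow_mul_rpow_le_one (inv_pos.2 hα) (inv_lt_one_of_one_lt₀ hα1) (by fun_prop)
    (by fun_prop) (lintegral_escort_eq_one hu0 hu) (lintegral_escort_eq_one hv0 hv)).1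

/-- The equality case: two densities of probability measures with normalized cross integral `1`
coincide. -/
lemma ae_eq_of_normalizedCross_eq_one (hα : 0 < α) (hα1 : α ≠ 1) (hum : Measurable u)
    (hvm : Measurable v) (hu0 : powerIntegral α μ u ≠ 0) (hu : powerIntegral α μ u ≠ ⊤)
    (hv0 : powerIntegral α μ v ≠ 0) (hv : powerIntegral α μ v ≠ ⊤)
    (hu1 : ∫⁻ x, u x ∂μ = 1) (hv1 : ∫⁻ x, v x ∂μ = 1) (h : normalizedCross α μ u v = 1) :
    u =ᵐ[μ] v := by
  rw [← lintegral_escort_rpow_mul_escort_rpow hα hu0 hu hv0 hv] at h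
  have key : (fun x => u x ^ α / powerIntegral α μ u) =ᵐ[μ]
      fun x => v x ^ α / powerIntegral α μ v := by
    rcases hα1.lt_or_gt with h1 | h1
    · exact (one_le_lintegral_rpow_mul_rpow ((one_lt_inv₀ hα).2 h1) (by fun_prop) (by fun_prop)
        (lintegral_escort_eq_one hu0 hu) (lintegral_escort_eq_one hv0 hv)).2 h
    · exact (lintegral_rpow_mul_rpow_le_one (inv_pos.2 hα) (inv_lt_one_of_one_lt₀ h1) (by fun_prop)
        (by fun_prop) (lintegral_escort_eq_one hu0 hu) (lintegral_escort_eq_one hv0 hv)).2 h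
  -- The α-th root of equal escort densities makes u and v proportional; total mass 1 on both sides
  -- then makes the constants agree.
  have key2 : (fun x => u x * (powerIntegral α μ u ^ α⁻¹)⁻¹) =ᵐ[μ]
      fun x => v x * (powerIntegral α μ v ^ α⁻¹)⁻¹ := by
    filter_upwards [key] with x hx
    have := congrArg (· ^ α⁻¹) hx
    simpa only [div_eq_mul_inv, ENNReal.mul_rpow_of_nonneg _ _ (inv_pos.2 hα).le,
      ENNReal.rpow_rpow_inv hα.ne', ENNReal.inv_rpow] using this
  have h3 := lintegral_congr_ae key2
  rw [lintegral_mul_const _ hum, lintegral_mul_const _ hvm, hu1, hv1, one_mul, one_mul] at h3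
  filter_upwards [key2] with x hx
  rw [h3] at hx
  have h1 : powerIntegral α μ v ^ α⁻¹ ≠ 0 := by simp [hv0, hv]
  have h2 : powerIntegral α μ v ^ α⁻¹ ≠ ⊤ := ENNReal.rpow_ne_top_of_nonneg (inv_pos.2 hα).le hv
  exact (ENNReal.mul_left_inj (ENNReal.inv_ne_zero.2 h2) (ENNReal.inv_ne_top.2 h1)).1 hx

end

/-! ### Closed form, order and definiteness of the relative α-entropy -/

section

variable {X : Type*} [MeasurableSpace X] {α : ℝ} {μ P Q R : Measure X}

lemma IsAdmissible.lintegral_rnDeriv [SigmaFinite μ] (hP : IsAdmissible α μ P) :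
    ∫⁻ x, P.rnDeriv μ x ∂μ = 1 := by
  have := hP.isProb
  rw [Measure.lintegral_rnDeriv hP.absCont, measure_univ]

lemma IsAdmissible.powerIntegral_ne_top (hP : IsAdmissible α μ P) :
    powerIntegral α μ (P.rnDeriv μ) ≠ ⊤ := hP.memLalpha.ne

lemma IsAdmissible.powerIntegral_ne_zero [SigmaFinite μ] (hα : 0 < α) (hP : IsAdmissible α μ P) :
    powerIntegral α μ (P.rnDeriv μ) ≠ 0 := by
  intro h
  rw [powerIntegral, lintegral_eq_zero_iff (by fun_prop)] at h
  have h2 : P.rnDeriv μ =ᵐ[μ] 0 := by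
    filter_upwards [h] with x hx
    simpa [ENNReal.rpow_eq_zero_iff, hα, hα.not_gt] using hx
  have h3 := hP.lintegral_rnDeriv
  rw [lintegral_congr_ae h2] at h3
  simp at h3

/-- Keeping 1/ρ as an exponent inside the logarithm reduces later comparisons to `ℝ≥0∞`, where only
the sign of 1/ρ matters: positive for α < 1, negative for α > 1. -/
lemma relEntropy_eq_log [SigmaFinite μ] (hα : 0 < α) (hα1 : α ≠ 1) (hP : IsAdmissible α μ P)
    (hQ : IsAdmissible α μ Q) :
    relEntropy α μ P Q =
      ENNReal.log (normalizedCross α μ (P.rnDeriv μ) (Q.rnDeriv μ) ^ (α⁻¹ - 1)⁻¹) := by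
  have hρ : α⁻¹ - 1 ≠ 0 := by
    intro h
    apply hα1
    rw [← inv_inj, inv_one]
    linarith
  rw [relEntropy, ENNReal.log_rpow, sign_mul_fDiv_add_one (a := escort α μ P)
    (b := escort α μ Q) hρ (by simpa using hα)
    (by unfold escort; fun_prop) (by unfold escort; fun_prop)
    (ae_escort_ne_top (by fun_prop) (hP.powerIntegral_ne_zero hα) hP.powerIntegral_ne_top)
    (lintegral_escort_eq_one (hQ.powerIntegral_ne_zero hα) hQ.powerIntegral_ne_top),
    EReal.toENNReal_coe, add_sub_cancel, neg_sub]
  congr 2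
  exact lintegral_escort_rpow_mul_escort_rpow hα (hP.powerIntegral_ne_zero hα)
    hP.powerIntegral_ne_top (hQ.powerIntegral_ne_zero hα) hQ.powerIntegral_ne_top

lemma inv_sub_one_inv_pos (hα : 0 < α) (hα1 : α < 1) : 0 < (α⁻¹ - 1)⁻¹ :=
  inv_pos.2 (sub_pos.2 ((one_lt_inv₀ hα).2 hα1))

lemma inv_sub_one_inv_neg (hα1 : 1 < α) : (α⁻¹ - 1)⁻¹ < 0 :=
  inv_lt_zero.2 (sub_neg.2 (inv_lt_one_of_one_lt₀ hα1))

lemma normalizing_factor_ne_zero {u v : X → ℝ≥0∞} (hα : 0 < α) (hu : powerIntegral α μ u ≠ ⊤)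
    (hv0 : powerIntegral α μ v ≠ 0) (hv : powerIntegral α μ v ≠ ⊤) :
    (powerIntegral α μ u ^ α⁻¹)⁻¹ * (powerIntegral α μ v ^ (1 - α⁻¹))⁻¹ ≠ 0 :=
  mul_ne_zero (ENNReal.inv_ne_zero.2 (ENNReal.rpow_ne_top_of_nonneg (inv_pos.2 hα).le hu))
    (ENNReal.inv_ne_zero.2 (ENNReal.rpow_ne_top_of_ne_zero hv0 hv))

lemma normalizing_factor_ne_top {u v : X → ℝ≥0∞} (hu0 : powerIntegral α μ u ≠ 0)
    (hu : powerIntegral α μ u ≠ ⊤)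
    (hv0 : powerIntegral α μ v ≠ 0) (hv : powerIntegral α μ v ≠ ⊤) :
    (powerIntegral α μ u ^ α⁻¹)⁻¹ * (powerIntegral α μ v ^ (1 - α⁻¹))⁻¹ ≠ ⊤ :=
  ENNReal.mul_ne_top (ENNReal.inv_ne_top.2 (by simp [hu, hu0]))
    (ENNReal.inv_ne_top.2 (by simp [hv, hv0]))

lemma relEntropy_lt_top_iff_of_lt_one [SigmaFinite μ] (hα : 0 < α) (hα1 : α < 1)
    (hP : IsAdmissible α μ P) (hQ : IsAdmissible α μ Q) :
    relEntropy α μ P Q < ⊤ ↔ crossIntegral α μ (P.rnDeriv μ) (Q.rnDeriv μ) ≠ ⊤ := by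
  have hf0 := normalizing_factor_ne_zero hα hP.powerIntegral_ne_top (hQ.powerIntegral_ne_zero hα)
    hQ.powerIntegral_ne_top
  have hf := normalizing_factor_ne_top (hP.powerIntegral_ne_zero hα) hP.powerIntegral_ne_top
    (hQ.powerIntegral_ne_zero hα) hQ.powerIntegral_ne_top
  have hκ := inv_sub_one_inv_pos hα hα1
  rw [relEntropy_eq_log hα hα1.ne hP hQ, lt_top_iff_ne_top, Ne, ENNReal.log_eq_top_iff,
    ENNReal.rpow_eq_top_iff, normalizedCross, ENNReal.mul_eq_top]
  simp [hf0, hf, hκ, hκ.not_gt]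

/-- Here 1/ρ < 0, so infinite entropy comes from 0 raised to a negative power, whereas for α < 1 it
comes from an infinite cross integral. -/
lemma relEntropy_lt_top_iff_of_one_lt [SigmaFinite μ] (hα1 : 1 < α)
    (hP : IsAdmissible α μ P) (hQ : IsAdmissible α μ Q) :
    relEntropy α μ P Q < ⊤ ↔ crossIntegral α μ (P.rnDeriv μ) (Q.rnDeriv μ) ≠ 0 := by
  have hα : 0 < α := by linarith
  have hf0 := normalizing_factor_ne_zero hα hP.powerIntegral_ne_top (hQ.powerIntegral_ne_zero hα)
    hQ.powerIntegral_ne_top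
  have hκ := inv_sub_one_inv_neg hα1
  rw [relEntropy_eq_log hα hα1.ne' hP hQ, lt_top_iff_ne_top, Ne, ENNReal.log_eq_top_iff,
    ENNReal.rpow_eq_top_iff, normalizedCross, mul_eq_zero]
  simp [hf0, hκ, hκ.not_gt]

/-- The factor depending on w is common and cancels. The cross-multiplied form is free of division
and linear in the cross integrals, as the segment argument needs. -/
lemma normalizedCross_le_iff {u v w : X → ℝ≥0∞} (hα : 0 < α) (hu0 : powerIntegral α μ u ≠ 0)
    (hu : powerIntegral α μ u ≠ ⊤) (hv0 : powerIntegral α μ v ≠ 0)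
    (hv : powerIntegral α μ v ≠ ⊤) (hw0 : powerIntegral α μ w ≠ 0)
    (hw : powerIntegral α μ w ≠ ⊤) :
    normalizedCross α μ u w ≤ normalizedCross α μ v w ↔
      crossIntegral α μ u w * powerIntegral α μ v ^ α⁻¹ ≤
        crossIntegral α μ v w * powerIntegral α μ u ^ α⁻¹ := by
  have hsu0 : powerIntegral α μ u ^ α⁻¹ ≠ 0 := by simp [hu, hu0]
  have hsv0 : powerIntegral α μ v ^ α⁻¹ ≠ 0 := by simp [hv, hv0]
  have hsw0 : powerIntegral α μ w ^ (1 - α⁻¹) ≠ 0 := by simp [hw, hw0]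
  have hsu := ENNReal.rpow_ne_top_of_nonneg (inv_pos.2 hα).le hu
  have hsv := ENNReal.rpow_ne_top_of_nonneg (inv_pos.2 hα).le hv
  have hsw := ENNReal.rpow_ne_top_of_ne_zero (y := 1 - α⁻¹) hw0 hw
  rw [normalizedCross, normalizedCross, ← mul_assoc, ← mul_assoc,
    ENNReal.mul_le_mul_iff_left (ENNReal.inv_ne_zero.2 hsw) (ENNReal.inv_ne_top.2 hsw0),
    ← div_eq_mul_inv, ← div_eq_mul_inv, ENNReal.div_le_iff hsu0 hsu, ENNReal.mul_comm_div,
    ← mul_div_assoc, ENNReal.le_div_iff_mul_le (.inl hsv0) (.inl hsv)]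

lemma relEntropy_le_iff_of_lt_one [SigmaFinite μ] (hα : 0 < α) (hα1 : α < 1)
    (hP : IsAdmissible α μ P) (hQ : IsAdmissible α μ Q) (hR : IsAdmissible α μ R) :
    relEntropy α μ P R ≤ relEntropy α μ Q R ↔
      crossIntegral α μ (P.rnDeriv μ) (R.rnDeriv μ) * powerIntegral α μ (Q.rnDeriv μ) ^ α⁻¹ ≤
        crossIntegral α μ (Q.rnDeriv μ) (R.rnDeriv μ) *
          powerIntegral α μ (P.rnDeriv μ) ^ α⁻¹ := by
  rw [relEntropy_eq_log hα hα1.ne hP hR, relEntropy_eq_log hα hα1.ne hQ hR,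
    ENNReal.log_strictMono.le_iff_le, ENNReal.rpow_le_rpow_iff (inv_sub_one_inv_pos hα hα1),
    normalizedCross_le_iff hα (hP.powerIntegral_ne_zero hα) hP.powerIntegral_ne_top
      (hQ.powerIntegral_ne_zero hα) hQ.powerIntegral_ne_top (hR.powerIntegral_ne_zero hα)
      hR.powerIntegral_ne_top]

lemma rpow_le_rpow_iff_of_neg' {x y : ℝ≥0∞} {z : ℝ} (hz : z < 0) : x ^ z ≤ y ^ z ↔ y ≤ x := by
  rw [← neg_neg z, ENNReal.rpow_neg x, ENNReal.rpow_neg y, ENNReal.inv_le_inv,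
    ENNReal.rpow_le_rpow_iff (neg_pos.2 hz)]

lemma relEntropy_le_iff_of_one_lt [SigmaFinite μ] (hα1 : 1 < α)
    (hP : IsAdmissible α μ P) (hQ : IsAdmissible α μ Q) (hR : IsAdmissible α μ R) :
    relEntropy α μ P R ≤ relEntropy α μ Q R ↔
      crossIntegral α μ (Q.rnDeriv μ) (R.rnDeriv μ) * powerIntegral α μ (P.rnDeriv μ) ^ α⁻¹ ≤
        crossIntegral α μ (P.rnDeriv μ) (R.rnDeriv μ) *
          powerIntegral α μ (Q.rnDeriv μ) ^ α⁻¹ := by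
  have hα : 0 < α := by linarith
  rw [relEntropy_eq_log hα hα1.ne' hP hR, relEntropy_eq_log hα hα1.ne' hQ hR,
    ENNReal.log_strictMono.le_iff_le, rpow_le_rpow_iff_of_neg' (inv_sub_one_inv_neg hα1),
    normalizedCross_le_iff hα (hQ.powerIntegral_ne_zero hα) hQ.powerIntegral_ne_top
      (hP.powerIntegral_ne_zero hα) hP.powerIntegral_ne_top (hR.powerIntegral_ne_zero hα)
      hR.powerIntegral_ne_top]

lemma relEntropy_nonneg [SigmaFinite μ] (hα : 0 < α) (hα1 : α ≠ 1) (hP : IsAdmissible α μ P)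
    (hQ : IsAdmissible α μ Q) : 0 ≤ relEntropy α μ P Q := by
  rw [relEntropy_eq_log hα hα1 hP hQ, ← ENNReal.log_one]
  refine ENNReal.log_monotone ?_
  rcases hα1.lt_or_gt with h | h
  · exact ENNReal.one_le_rpow (one_le_normalizedCross hα h (by fun_prop) (by fun_prop)
      (hP.powerIntegral_ne_zero hα) hP.powerIntegral_ne_top (hQ.powerIntegral_ne_zero hα)
      hQ.powerIntegral_ne_top) (inv_sub_one_inv_pos hα h)
  · rw [← ENNReal.one_rpow (α⁻¹ - 1)⁻¹, rpow_le_rpow_iff_of_neg' (inv_sub_one_inv_neg h)]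
    exact normalizedCross_le_one h (by fun_prop) (by fun_prop)
      (hP.powerIntegral_ne_zero hα) hP.powerIntegral_ne_top (hQ.powerIntegral_ne_zero hα)
      hQ.powerIntegral_ne_top

lemma eq_of_relEntropy_eq_zero [SigmaFinite μ] (hα : 0 < α) (hα1 : α ≠ 1)
    (hP : IsAdmissible α μ P) (hQ : IsAdmissible α μ Q) (h : relEntropy α μ P Q = 0) : P = Q := by
  have := hP.isProb
  have := hQ.isProb
  have hκ : (α⁻¹ - 1)⁻¹ ≠ 0 := by
    rcases hα1.lt_or_gt with h | h
    · exact (inv_sub_one_inv_pos hα h).ne'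
    · exact (inv_sub_one_inv_neg h).ne
  rw [relEntropy_eq_log hα hα1 hP hQ, ← ENNReal.log_one, ENNReal.log_eq_iff,
    ← ENNReal.one_rpow (α⁻¹ - 1)⁻¹, (ENNReal.rpow_left_injective hκ).eq_iff] at h
  have h2 := ae_eq_of_normalizedCross_eq_one hα hα1 (by fun_prop) (by fun_prop)
    (hP.powerIntegral_ne_zero hα) hP.powerIntegral_ne_top (hQ.powerIntegral_ne_zero hα)
    hQ.powerIntegral_ne_top hP.lintegral_rnDeriv hQ.lintegral_rnDeriv h
  rw [← Measure.withDensity_rnDeriv_eq P μ hP.absCont, withDensity_congr_ae h2,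
    Measure.withDensity_rnDeriv_eq Q μ hQ.absCont]

lemma relEntropy_add_relEntropy [SigmaFinite μ] (hα : 0 < α) (hα1 : α ≠ 1)
    (hP : IsAdmissible α μ P) (hQ : IsAdmissible α μ Q) (hR : IsAdmissible α μ R) :
    relEntropy α μ P Q + relEntropy α μ Q R =
      ENNReal.log ((normalizedCross α μ (P.rnDeriv μ) (Q.rnDeriv μ) *
        normalizedCross α μ (Q.rnDeriv μ) (R.rnDeriv μ)) ^ (α⁻¹ - 1)⁻¹) := by
  rw [relEntropy_eq_log hα hα1 hP hQ, relEntropy_eq_log hα hα1 hQ hR, ← ENNReal.log_mul_add]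
  rcases hα1.lt_or_gt with h | h
  · rw [ENNReal.mul_rpow_of_nonneg _ _ (inv_sub_one_inv_pos hα h).le]
  -- The exponent is negative, so the product rule could fail at 0 · ∞; both factors are at most 1.
  · rw [ENNReal.mul_rpow_of_ne_top]
    · exact ne_top_of_le_ne_top ENNReal.one_ne_top (normalizedCross_le_one h (by fun_prop)
        (by fun_prop) (hP.powerIntegral_ne_zero hα) hP.powerIntegral_ne_top
        (hQ.powerIntegral_ne_zero hα) hQ.powerIntegral_ne_top)
    · exact ne_top_of_le_ne_top ENNReal.one_ne_top (normalizedCross_le_one h (by fun_prop)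
        (by fun_prop) (hQ.powerIntegral_ne_zero hα) hQ.powerIntegral_ne_top
        (hR.powerIntegral_ne_zero hα) hR.powerIntegral_ne_top)

end

/-! ### From the power law to the Pythagorean relation and uniqueness -/

section

variable {X : Type*} [MeasurableSpace X] {α : ℝ} {μ P Q R : Measure X}

lemma crossIntegral_rnDeriv [SigmaFinite μ] (hP : IsAdmissible α μ P) {v : X → ℝ≥0∞}
    (hv : Measurable v) :
    crossIntegral α μ (P.rnDeriv μ) v = ∫⁻ x, v x ^ (α - 1) ∂P := by
  have := hP.isProb
  exact lintegral_rnDeriv_mul hP.absCont (by fun_prop)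

lemma mul_rpow_sub_one (hα : 0 < α) {a : ℝ≥0∞} (ha : a ≠ ⊤) : a * a ^ (α - 1) = a ^ α := by
  nth_rewrite 1 [← ENNReal.rpow_one a]
  rw [← ENNReal.rpow_add_of_add_pos ha _ _ (by linarith), add_sub_cancel]

lemma crossIntegral_self (hα : 0 < α) {u : X → ℝ≥0∞} (hu : ∀ᵐ x ∂μ, u x ≠ ⊤) :
    crossIntegral α μ u u = powerIntegral α μ u := by
  refine lintegral_congr_ae ?_
  filter_upwards [hu] with x hx using mul_rpow_sub_one hα hx

lemma IsAdmissible.ae_rnDeriv_ne_top [SigmaFinite μ] (hP : IsAdmissible α μ P) :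
    ∀ᵐ x ∂μ, P.rnDeriv μ x ≠ ⊤ := by
  have := hP.isProb
  exact Measure.rnDeriv_ne_top P μ

lemma lintegral_rnDeriv_rpow_sub_one [SigmaFinite μ] (hα : 0 < α) (hP : IsAdmissible α μ P) :
    ∫⁻ x, P.rnDeriv μ x ^ (α - 1) ∂P = powerIntegral α μ (P.rnDeriv μ) := by
  rw [← crossIntegral_rnDeriv hP (by fun_prop), crossIntegral_self hα hP.ae_rnDeriv_ne_top]

lemma IsAdmissible.ae_self_rnDeriv_ne_zero [SigmaFinite μ] (hP : IsAdmissible α μ P) :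
    ∀ᵐ x ∂P, P.rnDeriv μ x ≠ 0 := by
  have := hP.isProb
  filter_upwards [Measure.rnDeriv_pos hP.absCont] with x hx using hx.ne'

lemma IsAdmissible.ae_self_rpow_ne_top [SigmaFinite μ] (hP : IsAdmissible α μ P) :
    ∀ᵐ x ∂P, P.rnDeriv μ x ^ (α - 1) ≠ ⊤ := by
  filter_upwards [hP.ae_self_rnDeriv_ne_zero, hP.absCont.ae_le hP.ae_rnDeriv_ne_top] with x h1 h2
    using ENNReal.rpow_ne_top_of_ne_zero h1 h2

/-- For `α > 1` the cross integral of two densities is finite. -/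
lemma crossIntegral_ne_top_of_one_lt [SigmaFinite μ] (hα1 : 1 < α) (hP : IsAdmissible α μ P)
    (hQ : IsAdmissible α μ Q) : crossIntegral α μ (P.rnDeriv μ) (Q.rnDeriv μ) ≠ ⊤ := by
  have hα : 0 < α := by linarith
  intro h
  have h1 := normalizedCross_le_one hα1 (by fun_prop) (by fun_prop)
    (hP.powerIntegral_ne_zero hα) hP.powerIntegral_ne_top (hQ.powerIntegral_ne_zero hα)
    hQ.powerIntegral_ne_top
  rw [normalizedCross, h, ENNReal.top_mul (normalizing_factor_ne_zero hα hP.powerIntegral_ne_top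
    (hQ.powerIntegral_ne_zero hα) hQ.powerIntegral_ne_top)] at h1
  exact ENNReal.one_ne_top (top_le_iff.1 h1)

lemma integral_span_eq_zero {Γ : Type*} {f : Γ → X → ℝ} (hP : P ∈ linearFamily α μ f) {g : X → ℝ}
    (hg : g ∈ Submodule.span ℝ (Set.range f)) : Integrable g P ∧ ∫ x, g x ∂P = 0 := by
  induction hg using Submodule.span_induction with
  | mem x hx =>
    obtain ⟨γ, rfl⟩ := hx
    exact hP.2 γ
  | zero => exact ⟨integrable_zero _ _ _, by simp⟩
  | add x y _ _ hx hy =>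
    refine ⟨hx.1.add hy.1, ?_⟩
    simp only [Pi.add_apply]
    rw [integral_add hx.1 hy.1, hx.2, hy.2, add_zero]
  | smul a x _ hx =>
    refine ⟨hx.1.smul a, ?_⟩
    simp only [Pi.smul_apply]
    rw [integral_smul, hx.2, smul_zero]

/-- Both sides of an equation between extended reals may be replaced by real numbers. -/
lemma toReal_eq_of_coe_eq {a b : ℝ≥0∞} {c g : ℝ} (hb : c = 0 ∨ b ≠ ⊤)
    (h : (a : EReal) = (c : EReal) * (b : EReal) + (g : EReal)) :
    a ≠ ⊤ ∧ a.toReal = c * b.toReal + g := by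
  have h2 : (a : EReal) = ((c * b.toReal + g : ℝ) : EReal) := by
    rcases hb with rfl | hb
    · simpa using h
    · lift b to NNReal using hb
      rw [h]
      push_cast
      rfl
  have ha : a ≠ ⊤ := by
    rintro rfl
    exact EReal.coe_ne_top _ h2.symm
  refine ⟨ha, ?_⟩
  lift a to NNReal using ha
  have h3 : ((a : ℝ) : EReal) = ((c * b.toReal + g : ℝ) : EReal) := h2
  exact_mod_cast h3

lemma lintegral_eq_ofReal_integral_toReal {Y : Type*} [MeasurableSpace Y] {ν : Measure Y}
    {w : Y → ℝ≥0∞} (h : ∀ᵐ x ∂ν, w x ≠ ⊤)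
    (hi : Integrable (fun x => (w x).toReal) ν) :
    ∫⁻ x, w x ∂ν = ENNReal.ofReal (∫ x, (w x).toReal ∂ν) := by
  rw [ofReal_integral_eq_lintegral_ofReal hi (.of_forall fun x => ENNReal.toReal_nonneg)]
  refine lintegral_congr_ae ?_
  filter_upwards [h] with x hx using (ENNReal.ofReal_toReal hx).symm

/-- Integrating the power law against `Q` itself. -/
lemma HasPowerLawForm.pos_and [SigmaFinite μ] (hα : 0 < α) (hQ : IsAdmissible α μ Q)
    {c : ℝ} {g : X → ℝ} {N : Set X}
    (h : HasPowerLawForm α μ Q R c g N) (hg : Integrable g Q) (hg0 : ∫ x, g x ∂Q = 0) :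
    0 < c ∧ crossIntegral α μ (Q.rnDeriv μ) (R.rnDeriv μ) ≠ ⊤ ∧
      powerIntegral α μ (Q.rnDeriv μ) =
        ENNReal.ofReal c * crossIntegral α μ (Q.rnDeriv μ) (R.rnDeriv μ) := by
  have hS := lintegral_rnDeriv_rpow_sub_one hα hQ
  have hS0 := hQ.powerIntegral_ne_zero hα
  have hSt := hQ.powerIntegral_ne_top
  rw [crossIntegral_rnDeriv hQ (by fun_prop)]
  -- The value c = 0 is not yet excluded, and 0 · ∞ = 0 in `EReal`. If c ≠ 0, an infinite r^(α-1)
  -- would make the right side infinite where q^(α-1) is finite.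
  have key : ∀ᵐ x ∂Q, (c = 0 ∨ R.rnDeriv μ x ^ (α - 1) ≠ ⊤) ∧
      (Q.rnDeriv μ x ^ (α - 1)).toReal = c * (R.rnDeriv μ x ^ (α - 1)).toReal + g x := by
    filter_upwards [hQ.absCont.ae_le h, hQ.ae_self_rnDeriv_ne_zero, hQ.ae_self_rpow_ne_top]
      with x hx h0 hqt
    have hxN : x ∉ N := fun hxN => h0 (hx.2 hxN)
    have h1 := hx.1 hxN
    have h2 : c = 0 ∨ R.rnDeriv μ x ^ (α - 1) ≠ ⊤ := by
      by_contra! hc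
      rw [hc.2, EReal.coe_ennreal_top] at h1
      rcases hc.1.lt_or_gt with hc' | hc'
      · rw [EReal.coe_mul_top_of_neg hc', EReal.bot_add] at h1
        exact EReal.coe_ennreal_ne_bot _ h1
      · rw [EReal.coe_mul_top_of_pos hc', EReal.top_add_coe] at h1
        exact hqt (EReal.coe_ennreal_eq_top_iff.1 h1)
    exact ⟨h2, (toReal_eq_of_coe_eq h2 h1).2⟩
  have hqi : Integrable (fun x => (Q.rnDeriv μ x ^ (α - 1)).toReal) Q :=
    integrable_toReal_of_lintegral_ne_top (by fun_prop) (hS ▸ hSt)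
  -- Only the product with c is integrable so far, as the difference q^(α-1) - g; r^(α-1) itself
  -- follows once c > 0.
  have hri : Integrable (fun x => c * (R.rnDeriv μ x ^ (α - 1)).toReal) Q := by
    refine (hqi.sub hg).congr ?_
    filter_upwards [key] with x hx
    simp [hx.2]
  have hI : (powerIntegral α μ (Q.rnDeriv μ)).toReal =
      c * ∫ x, (R.rnDeriv μ x ^ (α - 1)).toReal ∂Q := by
    rw [← hS, ← integral_toReal (by fun_prop)
      (hQ.ae_self_rpow_ne_top.mono fun x hx => hx.lt_top), ← integral_const_mul,
      integral_congr_ae (key.mono fun x hx => hx.2), integral_add hri hg, hg0, add_zero]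
  have hpos : 0 < c * ∫ x, (R.rnDeriv μ x ^ (α - 1)).toReal ∂Q :=
    hI ▸ ENNReal.toReal_pos hS0 hSt
  have hcpos : 0 < c :=
    pos_of_mul_pos_left hpos (integral_nonneg fun x => ENNReal.toReal_nonneg)
  have hri' : Integrable (fun x => (R.rnDeriv μ x ^ (α - 1)).toReal) Q :=
    (integrable_const_mul_iff (IsUnit.mk0 c hcpos.ne') _).1 hri
  have hA := lintegral_eq_ofReal_integral_toReal
    (key.mono fun x hx => hx.1.resolve_left hcpos.ne') hri'
  refine ⟨hcpos, by rw [hA]; exact ENNReal.ofReal_ne_top, ?_⟩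
  rw [hA, ← ENNReal.ofReal_mul hcpos.le, ← hI, ENNReal.ofReal_toReal hSt]

/-- Integrating the power law against another member of the linear family, `α < 1`. -/
lemma HasPowerLawForm.crossIntegral_eq [SigmaFinite μ]
    (hP : IsAdmissible α μ P) {c : ℝ} (hc : 0 < c) {g : X → ℝ} {N : Set X}
    (h : HasPowerLawForm α μ Q R c g N) (hg : Integrable g P) (hg0 : ∫ x, g x ∂P = 0)
    (hPN : P N = 0) (hB : crossIntegral α μ (P.rnDeriv μ) (R.rnDeriv μ) ≠ ⊤) :
    crossIntegral α μ (P.rnDeriv μ) (Q.rnDeriv μ) =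
      ENNReal.ofReal c * crossIntegral α μ (P.rnDeriv μ) (R.rnDeriv μ) := by
  rw [crossIntegral_rnDeriv hP (by fun_prop)] at hB
  rw [crossIntegral_rnDeriv hP (by fun_prop), crossIntegral_rnDeriv hP (by fun_prop)]
  have hrt : ∀ᵐ x ∂P, R.rnDeriv μ x ^ (α - 1) < ⊤ := ae_lt_top (by fun_prop) hB
  have key : ∀ᵐ x ∂P, Q.rnDeriv μ x ^ (α - 1) ≠ ⊤ ∧
      (Q.rnDeriv μ x ^ (α - 1)).toReal = c * (R.rnDeriv μ x ^ (α - 1)).toReal + g x := by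
    filter_upwards [hP.absCont.ae_le h, hrt, measure_eq_zero_iff_ae_notMem.1 hPN] with x hx h1 h2
    exact toReal_eq_of_coe_eq (.inr h1.ne) (hx.1 h2)
  have hri : Integrable (fun x => c * (R.rnDeriv μ x ^ (α - 1)).toReal) P :=
    (integrable_toReal_of_lintegral_ne_top (by fun_prop) hB).const_mul c
  have hqi : Integrable (fun x => (Q.rnDeriv μ x ^ (α - 1)).toReal) P := by
    refine (hri.add hg).congr ?_
    filter_upwards [key] with x hx
    simp [hx.2]
  rw [lintegral_eq_ofReal_integral_toReal (key.mono fun x hx => hx.1) hqi,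
    integral_congr_ae (key.mono fun x hx => hx.2), integral_add hri hg, hg0, add_zero,
    integral_const_mul, integral_toReal (by fun_prop) hrt, ENNReal.ofReal_mul hc.le,
    ENNReal.ofReal_toReal hB]

/-- Integrating the power law against another member of the linear family, `α > 1`. -/
lemma HasPowerLawForm.le_crossIntegral [SigmaFinite μ] (hα1 : 1 < α)
    (hP : IsAdmissible α μ P) (hQ : IsAdmissible α μ Q) (hR : IsAdmissible α μ R)
    {c : ℝ} (hc : 0 < c) {g : X → ℝ} {N : Set X} (hN : MeasurableSet N)
    (h : HasPowerLawForm α μ Q R c g N) (hg : IntegrableOn g Nᶜ P)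
    (hside : (c : EReal) * ((∫⁻ x in N, (R.rnDeriv μ x) ^ (α - 1) ∂P : ℝ≥0∞) : EReal)
        ≤ ((∫ x in Nᶜ, g x ∂P : ℝ) : EReal)) :
    ENNReal.ofReal c * crossIntegral α μ (P.rnDeriv μ) (R.rnDeriv μ) ≤
      crossIntegral α μ (P.rnDeriv μ) (Q.rnDeriv μ) := by
  have hB := crossIntegral_ne_top_of_one_lt hα1 hP hR
  have hC := crossIntegral_ne_top_of_one_lt hα1 hP hQ
  rw [crossIntegral_rnDeriv hP (by fun_prop)] at hB hC
  rw [crossIntegral_rnDeriv hP (by fun_prop), crossIntegral_rnDeriv hP (by fun_prop)]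
  have hrt : ∀ᵐ x ∂P, R.rnDeriv μ x ^ (α - 1) < ⊤ := ae_lt_top (by fun_prop) hB
  have hqt : ∀ᵐ x ∂P, Q.rnDeriv μ x ^ (α - 1) < ⊤ := ae_lt_top (by fun_prop) hC
  have hri : Integrable (fun x => (R.rnDeriv μ x ^ (α - 1)).toReal) P :=
    integrable_toReal_of_lintegral_ne_top (by fun_prop) hB
  have hqi : Integrable (fun x => (Q.rnDeriv μ x ^ (α - 1)).toReal) P :=
    integrable_toReal_of_lintegral_ne_top (by fun_prop) hC
  have hBN : ∫⁻ x in N, (R.rnDeriv μ x) ^ (α - 1) ∂P ≠ ⊤ :=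
    ne_top_of_le_ne_top hB (setLIntegral_le_lintegral _ _)
  have hside' : c * ∫ x in N, (R.rnDeriv μ x ^ (α - 1)).toReal ∂P ≤ ∫ x in Nᶜ, g x ∂P := by
    rw [integral_toReal (by fun_prop) (ae_restrict_of_ae hrt)]
    rw [← ENNReal.ofReal_toReal hBN, EReal.coe_ennreal_ofReal,
      max_eq_left ENNReal.toReal_nonneg] at hside
    exact_mod_cast hside
  have hoff : ∫ x in Nᶜ, (Q.rnDeriv μ x ^ (α - 1)).toReal ∂P =
      c * ∫ x in Nᶜ, (R.rnDeriv μ x ^ (α - 1)).toReal ∂P + ∫ x in Nᶜ, g x ∂P := by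
    rw [← integral_const_mul, ← integral_add (hri.integrableOn.const_mul c) hg]
    refine setIntegral_congr_ae hN.compl ?_
    filter_upwards [hP.absCont.ae_le h, hrt] with x hx h1 h2
    exact (toReal_eq_of_coe_eq (.inr h1.ne) (hx.1 h2)).2
  -- On N only this sign is needed: the missing term c ∫_N r^(α-1) dP is covered by the integral of
  -- g off N.
  have hqN : 0 ≤ ∫ x in N, (Q.rnDeriv μ x ^ (α - 1)).toReal ∂P :=
    integral_nonneg fun x => ENNReal.toReal_nonneg
  have hq := integral_add_compl hN hqi
  have hr := integral_add_compl hN hri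
  rw [lintegral_eq_ofReal_integral_toReal (hqt.mono fun x hx => hx.ne) hqi,
    lintegral_eq_ofReal_integral_toReal (hrt.mono fun x hx => hx.ne) hri,
    ← ENNReal.ofReal_mul hc.le]
  apply ENNReal.ofReal_le_ofReal
  rw [← hq, ← hr, mul_add]
  linarith

/-- Telescoping: ‖v‖ · ‖v‖^(α-1) = ∫ v^α = k A(v,w) cancels. Here `d` stands for A(u,w) and `k * d`
for A(u,v) or a lower bound of it, so one identity serves both ranges of α. -/
lemma normalizedCross_mul_normalizedCross {u v w : X → ℝ≥0∞} {k : ℝ≥0∞}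
    (hv0 : powerIntegral α μ v ≠ 0) (hv : powerIntegral α μ v ≠ ⊤)
    (hk : powerIntegral α μ v = k * crossIntegral α μ v w) (d : ℝ≥0∞) :
    (k * d) * ((powerIntegral α μ u ^ α⁻¹)⁻¹ * (powerIntegral α μ v ^ (1 - α⁻¹))⁻¹) *
      normalizedCross α μ v w =
      d * ((powerIntegral α μ u ^ α⁻¹)⁻¹ * (powerIntegral α μ w ^ (1 - α⁻¹))⁻¹) := by
  have h1 : powerIntegral α μ v ^ α⁻¹ * powerIntegral α μ v ^ (1 - α⁻¹) = powerIntegral α μ v :=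
    rpow_mul_rpow_self hv
  have hv1 : powerIntegral α μ v ^ α⁻¹ ≠ 0 := by simp [hv0, hv]
  have hv2 : powerIntegral α μ v ^ (1 - α⁻¹) ≠ 0 := by simp [hv0, hv]
  have h2 : (powerIntegral α μ v ^ α⁻¹)⁻¹ * (powerIntegral α μ v ^ (1 - α⁻¹))⁻¹ =
      (powerIntegral α μ v)⁻¹ := by
    rw [← ENNReal.mul_inv (.inl hv1) (.inr hv2), h1]
  calc _ = d * ((powerIntegral α μ u ^ α⁻¹)⁻¹ * (powerIntegral α μ w ^ (1 - α⁻¹))⁻¹) *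
        ((k * crossIntegral α μ v w) *
          ((powerIntegral α μ v ^ α⁻¹)⁻¹ * (powerIntegral α μ v ^ (1 - α⁻¹))⁻¹)) := by
        rw [normalizedCross]; ring
    _ = _ := by rw [h2, ← hk, ENNReal.mul_inv_cancel hv0 hv, mul_one]

/-- The Pythagorean inequality for a measure of power-law form. -/
lemma pythagorean_of_hasPowerLawForm [SigmaFinite μ] (hα : 0 < α) (hα1 : α ≠ 1) {Γ : Type*}
    {f : Γ → X → ℝ} (hR : IsAdmissible α μ R) (hQ : Q ∈ linearFamily α μ f) {c : ℝ} {g : X → ℝ}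
    {N : Set X} (hN : MeasurableSet N) (hg : g ∈ Submodule.span ℝ (Set.range f))
    (h : HasPowerLawForm α μ Q R c g N) (hs : SideCondition α μ (linearFamily α μ f) R c g N)
    (hP : P ∈ linearFamily α μ f) (hPR : relEntropy α μ P R < ⊤) :
    relEntropy α μ P Q + relEntropy α μ Q R ≤ relEntropy α μ P R ∧
      (α < 1 → relEntropy α μ P R = relEntropy α μ P Q + relEntropy α μ Q R) := by
  have hgQ := integral_span_eq_zero hQ hg
  have hgP := integral_span_eq_zero hP hg
  obtain ⟨hc, -, hSA⟩ := h.pos_and hα hQ.1 hgQ.1 hgQ.2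
  have hS0 := hQ.1.powerIntegral_ne_zero hα
  have hSt := hQ.1.powerIntegral_ne_top
  have key := normalizedCross_mul_normalizedCross (u := P.rnDeriv μ) hS0 hSt hSA
    (crossIntegral α μ (P.rnDeriv μ) (R.rnDeriv μ))
  rw [relEntropy_add_relEntropy hα hα1 hP.1 hQ.1 hR, relEntropy_eq_log hα hα1 hP.1 hR]
  rcases hα1.lt_or_gt with hlt | hgt
  · have hB := (relEntropy_lt_top_iff_of_lt_one hα hlt hP.1 hR).1 hPR
    have hC := h.crossIntegral_eq hP.1 hc hgP.1 hgP.2 ((hs P hP hPR).1 hlt) hB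
    have : normalizedCross α μ (P.rnDeriv μ) (R.rnDeriv μ) =
        normalizedCross α μ (P.rnDeriv μ) (Q.rnDeriv μ) *
          normalizedCross α μ (Q.rnDeriv μ) (R.rnDeriv μ) := by
      rw [normalizedCross, ← key, normalizedCross.eq_1 α μ (P.rnDeriv μ), hC]
    rw [this]
    exact ⟨le_rfl, fun _ => rfl⟩
  · refine ⟨ENNReal.log_monotone ?_, fun h' => absurd h' hgt.not_gt⟩
    obtain ⟨hgi, hgs⟩ := (hs P hP hPR).2 hgt
    have hC := h.le_crossIntegral hgt hP.1 hQ.1 hR hc hN hgi hgs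
    rw [rpow_le_rpow_iff_of_neg' (inv_sub_one_inv_neg hgt), normalizedCross, ← key,
      normalizedCross.eq_1 α μ (P.rnDeriv μ)]
    gcongr

lemma relEntropy_lt_top_of_hasPowerLawForm [SigmaFinite μ] (hα : 0 < α) (hα1 : α ≠ 1) {Γ : Type*}
    {f : Γ → X → ℝ} (hR : IsAdmissible α μ R) (hQ : Q ∈ linearFamily α μ f) {c : ℝ} {g : X → ℝ}
    {N : Set X} (hg : g ∈ Submodule.span ℝ (Set.range f))
    (h : HasPowerLawForm α μ Q R c g N) : relEntropy α μ Q R < ⊤ := by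
  have hgQ := integral_span_eq_zero hQ hg
  obtain ⟨hc, hA, hSA⟩ := h.pos_and hα hQ.1 hgQ.1 hgQ.2
  rcases hα1.lt_or_gt with hlt | hgt
  · exact (relEntropy_lt_top_iff_of_lt_one hα hlt hQ.1 hR).2 hA
  · rw [relEntropy_lt_top_iff_of_one_lt hgt hQ.1 hR]
    intro h0
    exact hQ.1.powerIntegral_ne_zero hα (by rw [hSA, h0, mul_zero])

/-- For a second projection Q', I(Q',R) = I(Q,R) is finite and can be cancelled from the Pythagorean
inequality, leaving I(Q',Q) = 0. -/
lemma isForwardProjection_of_pythagorean [SigmaFinite μ] (hα : 0 < α) (hα1 : α ≠ 1) {Γ : Type*}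
    {f : Γ → X → ℝ} (hQ : Q ∈ linearFamily α μ f)
    (hfin : relEntropy α μ Q R < ⊤) (hR : IsAdmissible α μ R)
    (hpyth : ∀ P ∈ linearFamily α μ f, relEntropy α μ P R < ⊤ →
      relEntropy α μ P Q + relEntropy α μ Q R ≤ relEntropy α μ P R) :
    IsForwardProjection α μ (linearFamily α μ f) R Q ∧
      ∀ Q', IsForwardProjection α μ (linearFamily α μ f) R Q' → Q' = Q := by
  have hmin : relEntropy α μ Q R = ⨅ P ∈ linearFamily α μ f, relEntropy α μ P R := by
    refine le_antisymm (le_iInf₂ fun P hP => ?_) (iInf₂_le Q hQ)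
    by_cases hPR : relEntropy α μ P R < ⊤
    · refine le_trans ?_ (hpyth P hP hPR)
      exact le_add_of_nonneg_left (relEntropy_nonneg hα hα1 hP.1 hQ.1)
    · rw [not_lt_top_iff.1 hPR]
      exact le_top
  refine ⟨⟨⟨Q, hQ, hfin⟩, hQ, hmin⟩, fun Q' hQ' => ?_⟩
  have heq : relEntropy α μ Q' R = relEntropy α μ Q R := hQ'.eq_iInf.trans hmin.symm
  have h1 := hpyth Q' hQ'.mem (heq ▸ hfin)
  have h0 := relEntropy_nonneg hα hα1 hQ'.mem.1 hQ.1
  have hQ0 := relEntropy_nonneg hα hα1 hQ.1 hR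
  rw [heq] at h1
  refine eq_of_relEntropy_eq_zero hα hα1 hQ'.mem.1 hQ.1 (le_antisymm ?_ h0)
  lift relEntropy α μ Q R to ℝ using ⟨hfin.ne, (lt_of_lt_of_le EReal.bot_lt_zero hQ0).ne'⟩ with y
  have h2 : relEntropy α μ Q' Q + (y : EReal) ≤ 0 + y := by simpa using h1
  exact (EReal.addLECancellable_coe y).add_le_add_iff_right.1 h2

end

/-! ### First-order inequality along a segment -/

section

lemma mix_le_add {s t : ℝ≥0∞} (hst : s + t = 1) (a b : ℝ≥0∞) : s * a + t * b ≤ a + b := by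
  have hs : s ≤ 1 := hst ▸ le_self_add
  have ht : t ≤ 1 := hst ▸ le_add_self
  exact add_le_add (mul_le_of_le_one_left' hs) (mul_le_of_le_one_left' ht)

variable {X : Type*} [MeasurableSpace X] {α : ℝ} {μ : Measure X} {u v w : X → ℝ≥0∞} {s t : ℝ≥0∞}

lemma powerIntegral_add_ne_top (hα : 0 < α) (hvm : Measurable v)
    (hu : powerIntegral α μ u ≠ ⊤) (hv : powerIntegral α μ v ≠ ⊤) :
    powerIntegral α μ (fun x => v x + u x) ≠ ⊤ := by
  refine ne_top_of_le_ne_top ?_ (lintegral_mono fun x =>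
    ENNReal.add_rpow_le_two_rpow_mul_rpow_add_rpow (v x) (u x) hα.le)
  rw [lintegral_const_mul' _ _ (by finiteness), lintegral_add_left (by fun_prop)]
  exact ENNReal.mul_ne_top (by finiteness) (ENNReal.add_ne_top.2 ⟨hv, hu⟩)

lemma powerIntegral_mix_ne_top (hα : 0 < α) (hvm : Measurable v)
    (hu : powerIntegral α μ u ≠ ⊤) (hv : powerIntegral α μ v ≠ ⊤) (hst : s + t = 1) :
    powerIntegral α μ (fun x => s * v x + t * u x) ≠ ⊤ :=
  ne_top_of_le_ne_top (powerIntegral_add_ne_top hα hvm hu hv) (lintegral_mono fun _ =>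
    ENNReal.rpow_le_rpow (mix_le_add hst _ _) hα.le)

lemma rpow_mul_powerIntegral_le_mix (hα : 0 < α) (hs : s ≠ ⊤) :
    s ^ α * powerIntegral α μ v ≤ powerIntegral α μ (fun x => s * v x + t * u x) := by
  rw [powerIntegral, ← lintegral_const_mul' _ _ (ENNReal.rpow_ne_top_of_nonneg hα.le hs)]
  refine lintegral_mono fun x => ?_
  rw [← ENNReal.mul_rpow_of_nonneg _ _ hα.le]
  exact ENNReal.rpow_le_rpow le_self_add hα.le

lemma powerIntegral_mix_ne_zero (hα : 0 < α) (hs0 : s ≠ 0) (hs : s ≠ ⊤)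
    (hv0 : powerIntegral α μ v ≠ 0) :
    powerIntegral α μ (fun x => s * v x + t * u x) ≠ 0 := by
  intro h
  have := rpow_mul_powerIntegral_le_mix (μ := μ) (u := u) (v := v) (t := t) hα hs
  rw [h, nonpos_iff_eq_zero, mul_eq_zero] at this
  exact this.elim (by simp [hs0, hs]) hv0

lemma crossIntegral_mix_left (hvm : Measurable v) (hum : Measurable u) (hwm : Measurable w) :
    crossIntegral α μ (fun x => s * v x + t * u x) w =
      s * crossIntegral α μ v w + t * crossIntegral α μ u w := by
  rw [crossIntegral, crossIntegral, crossIntegral, ← lintegral_const_mul _ (by fun_prop),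
    ← lintegral_const_mul _ (by fun_prop), ← lintegral_add_left (by fun_prop)]
  refine lintegral_congr fun x => ?_
  ring

/-- Writing m^α = m · m^(α-1) and splitting only the first factor replaces differentiation of the
norm along the segment. -/
lemma powerIntegral_mix_eq (hα : 0 < α) (hvm : Measurable v) (hum : Measurable u)
    (hu : powerIntegral α μ u ≠ ⊤) (hv : powerIntegral α μ v ≠ ⊤) (hst : s + t = 1) :
    powerIntegral α μ (fun x => s * v x + t * u x) =
      s * crossIntegral α μ v (fun x => s * v x + t * u x) +
        t * crossIntegral α μ u (fun x => s * v x + t * u x) := by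
  rw [← crossIntegral_mix_left hvm hum (by fun_prop), crossIntegral_self hα]
  exact ae_ne_top_of_powerIntegral_ne_top hα (by fun_prop)
    (powerIntegral_mix_ne_top hα hvm hu hv hst)

/-- The reverse Hölder inequality with denominators cleared. -/
lemma le_crossIntegral_of_lt_one (hα : 0 < α) (hα1 : α < 1) (hum : Measurable u)
    (hvm : Measurable v) (hu0 : powerIntegral α μ u ≠ 0) (hu : powerIntegral α μ u ≠ ⊤)
    (hv0 : powerIntegral α μ v ≠ 0) (hv : powerIntegral α μ v ≠ ⊤) :
    powerIntegral α μ u ^ α⁻¹ * powerIntegral α μ v ^ (1 - α⁻¹) ≤ crossIntegral α μ u v := by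
  have h := one_le_normalizedCross hα hα1 hum hvm hu0 hu hv0 hv
  have h1 : powerIntegral α μ u ^ α⁻¹ ≠ 0 := by simp [hu0, hu]
  have h2 : powerIntegral α μ v ^ (1 - α⁻¹) ≠ 0 := by simp [hv0, hv]
  have h3 := ENNReal.rpow_ne_top_of_ne_zero (y := α⁻¹) hu0 hu
  have h4 := ENNReal.rpow_ne_top_of_ne_zero (y := 1 - α⁻¹) hv0 hv
  rwa [normalizedCross, ← ENNReal.mul_inv (.inl h1) (.inr h2), ← div_eq_mul_inv,
    ENNReal.le_div_iff_mul_le (.inl (mul_ne_zero h1 h2)) (.inl (ENNReal.mul_ne_top h3 h4)),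
    one_mul] at h

lemma crossIntegral_le_of_one_lt (hα1 : 1 < α) (hum : Measurable u)
    (hvm : Measurable v) (hu0 : powerIntegral α μ u ≠ 0) (hu : powerIntegral α μ u ≠ ⊤)
    (hv0 : powerIntegral α μ v ≠ 0) (hv : powerIntegral α μ v ≠ ⊤) :
    crossIntegral α μ u v ≤ powerIntegral α μ u ^ α⁻¹ * powerIntegral α μ v ^ (1 - α⁻¹) := by
  have h := normalizedCross_le_one hα1 hum hvm hu0 hu hv0 hv
  have h1 : powerIntegral α μ u ^ α⁻¹ ≠ 0 := by simp [hu0, hu]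
  have h2 : powerIntegral α μ v ^ (1 - α⁻¹) ≠ 0 := by simp [hv0, hv]
  have h3 := ENNReal.rpow_ne_top_of_ne_zero (y := α⁻¹) hu0 hu
  have h4 := ENNReal.rpow_ne_top_of_ne_zero (y := 1 - α⁻¹) hv0 hv
  rwa [normalizedCross, ← ENNReal.mul_inv (.inl h1) (.inr h2), ← div_eq_mul_inv,
    ENNReal.div_le_iff (mul_ne_zero h1 h2) (ENNReal.mul_ne_top h3 h4), one_mul] at h

lemma powerIntegral_rpow_mul_rpow (hv : powerIntegral α μ v ≠ ⊤) :
    powerIntegral α μ v ^ α⁻¹ * powerIntegral α μ v ^ (1 - α⁻¹) = powerIntegral α μ v :=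
  rpow_mul_rpow_self hv

/-- Homogeneity ‖s v‖^(α-1) = s^(α-1) ‖v‖^(α-1), for S = ∫ v^α. -/
lemma rpow_mul_rpow_one_sub_inv (hα : 0 < α) {S : ℝ≥0∞} (hs0 : s ≠ 0) (hs : s ≠ ⊤) :
    (s ^ α * S) ^ (1 - α⁻¹) = s ^ (α - 1) * S ^ (1 - α⁻¹) := by
  rw [mul_comm, mul_rpow_of_ne_zero_of_ne_top _ (by simp [hs0, hs])
    (ENNReal.rpow_ne_top_of_nonneg hα.le hs), ← ENNReal.rpow_mul, mul_comm,
    show α * (1 - α⁻¹) = α - 1 by field_simp]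

/-- First-order consequence of minimality along a segment, before passing to the limit. -/
lemma mul_crossIntegral_mix_le (hα : 0 < α) (hα1 : α < 1) (hum : Measurable u)
    (hvm : Measurable v) (hu : powerIntegral α μ u ≠ ⊤)
    (hv0 : powerIntegral α μ v ≠ 0) (hv : powerIntegral α μ v ≠ ⊤)
    (hst : s + t = 1) (hs0 : s ≠ 0) (ht0 : t ≠ 0) {A B : ℝ≥0∞} (hA : A ≠ ⊤)
    (hmin : A * powerIntegral α μ (fun x => s * v x + t * u x) ^ α⁻¹ ≤
      (s * A + t * B) * powerIntegral α μ v ^ α⁻¹) :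
    A * crossIntegral α μ u (fun x => s * v x + t * u x) ≤
      s ^ (α - 1) * (powerIntegral α μ v * B) := by
  have hs : s ≠ ⊤ := ne_top_of_le_ne_top ENNReal.one_ne_top (hst ▸ le_self_add)
  have ht : t ≠ ⊤ := ne_top_of_le_ne_top ENNReal.one_ne_top (hst ▸ le_add_self)
  have hM := powerIntegral_mix_ne_top hα hvm hu hv hst
  have hM0 := powerIntegral_mix_ne_zero (u := u) (t := t) hα hs0 hs hv0
  have hMeq := powerIntegral_mix_eq hα hvm hum hu hv hst
  have hMge := rpow_mul_powerIntegral_le_mix (μ := μ) (u := u) (v := v) (t := t) hα hs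
  have hcross := le_crossIntegral_of_lt_one hα hα1 hvm
    (show Measurable fun x => s * v x + t * u x by fun_prop) hv0 hv hM0 hM
  have hMM := powerIntegral_rpow_mul_rpow hM
  have hSS := powerIntegral_rpow_mul_rpow hv
  have hM't := ENNReal.rpow_ne_top_of_ne_zero (y := 1 - α⁻¹) hM0 hM
  have hSt := ENNReal.rpow_ne_top_of_ne_zero (y := α⁻¹) hv0 hv
  have hM'le : powerIntegral α μ (fun x => s * v x + t * u x) ^ (1 - α⁻¹) ≤
      s ^ (α - 1) * powerIntegral α μ v ^ (1 - α⁻¹) := by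
    rw [← rpow_mul_rpow_one_sub_inv hα hs0 hs,
      rpow_le_rpow_iff_of_neg' (by linarith [(one_lt_inv₀ hα).2 hα1])]
    exact hMge
  generalize powerIntegral α μ (fun x => s * v x + t * u x) = M at *
  generalize crossIntegral α μ u (fun x => s * v x + t * u x) = K at *
  generalize crossIntegral α μ v (fun x => s * v x + t * u x) = K' at *
  generalize powerIntegral α μ v = S at *
  -- Minimality is multiplied by ‖m‖^(α-1) and ‖m‖^α is expanded. Reverse Hölder bounds the v-part
  -- below, so the terms with s A cancel and t can be divided out.
  have h1 : s * A * (S ^ α⁻¹ * M ^ (1 - α⁻¹)) + t * (A * K) ≤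
      s * A * (S ^ α⁻¹ * M ^ (1 - α⁻¹)) + t * (B * (S ^ α⁻¹ * M ^ (1 - α⁻¹))) :=
    calc _ ≤ s * A * K' + t * (A * K) := by gcongr
      _ = A * (s * K' + t * K) := by ring
      _ = A * M ^ α⁻¹ * M ^ (1 - α⁻¹) := by rw [← hMeq, mul_assoc, hMM]
      _ ≤ (s * A + t * B) * S ^ α⁻¹ * M ^ (1 - α⁻¹) := by gcongr
      _ = _ := by ring
  have h2 := (ENNReal.add_le_add_iff_left (by finiteness)).1 h1
  have h3 := (ENNReal.mul_le_mul_iff_right ht0 ht).1 h2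
  calc A * K ≤ B * (S ^ α⁻¹ * M ^ (1 - α⁻¹)) := h3
    _ ≤ B * (S ^ α⁻¹ * (s ^ (α - 1) * S ^ (1 - α⁻¹))) := by gcongr
    _ = s ^ (α - 1) * ((S ^ α⁻¹ * S ^ (1 - α⁻¹)) * B) := by ring
    _ = _ := by rw [hSS]

/-- First-order consequence of maximality along a segment, before passing to the limit. -/
lemma le_mul_crossIntegral_mix (hα1 : 1 < α) (hum : Measurable u)
    (hvm : Measurable v) (hu : powerIntegral α μ u ≠ ⊤)
    (hv0 : powerIntegral α μ v ≠ 0) (hv : powerIntegral α μ v ≠ ⊤)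
    (hst : s + t = 1) (hs0 : s ≠ 0) (ht0 : t ≠ 0) {A B : ℝ≥0∞} (hA : A ≠ ⊤)
    (hmin : (s * A + t * B) * powerIntegral α μ v ^ α⁻¹ ≤
      A * powerIntegral α μ (fun x => s * v x + t * u x) ^ α⁻¹) :
    s ^ (α - 1) * (powerIntegral α μ v * B) ≤
      A * crossIntegral α μ u (fun x => s * v x + t * u x) := by
  have hα : 0 < α := by linarith
  have hs : s ≠ ⊤ := ne_top_of_le_ne_top ENNReal.one_ne_top (hst ▸ le_self_add)
  have ht : t ≠ ⊤ := ne_top_of_le_ne_top ENNReal.one_ne_top (hst ▸ le_add_self)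
  have hM := powerIntegral_mix_ne_top hα hvm hu hv hst
  have hM0 := powerIntegral_mix_ne_zero (u := u) (t := t) hα hs0 hs hv0
  have hMeq := powerIntegral_mix_eq hα hvm hum hu hv hst
  have hMge := rpow_mul_powerIntegral_le_mix (μ := μ) (u := u) (v := v) (t := t) hα hs
  have hcross := crossIntegral_le_of_one_lt hα1 hvm
    (show Measurable fun x => s * v x + t * u x by fun_prop) hv0 hv hM0 hM
  have hMM := powerIntegral_rpow_mul_rpow hM
  have hSS := powerIntegral_rpow_mul_rpow hv
  have hM't := ENNReal.rpow_ne_top_of_ne_zero (y := 1 - α⁻¹) hM0 hM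
  have hSt := ENNReal.rpow_ne_top_of_ne_zero (y := α⁻¹) hv0 hv
  have hM'le : s ^ (α - 1) * powerIntegral α μ v ^ (1 - α⁻¹) ≤
      powerIntegral α μ (fun x => s * v x + t * u x) ^ (1 - α⁻¹) := by
    rw [← rpow_mul_rpow_one_sub_inv hα hs0 hs]
    exact ENNReal.rpow_le_rpow hMge (by linarith [inv_lt_one_of_one_lt₀ hα1])
  generalize powerIntegral α μ (fun x => s * v x + t * u x) = M at *
  generalize crossIntegral α μ u (fun x => s * v x + t * u x) = K at *
  generalize crossIntegral α μ v (fun x => s * v x + t * u x) = K' at *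
  generalize powerIntegral α μ v = S at *
  have h1 : s * A * (S ^ α⁻¹ * M ^ (1 - α⁻¹)) + t * (B * (S ^ α⁻¹ * M ^ (1 - α⁻¹))) ≤
      s * A * (S ^ α⁻¹ * M ^ (1 - α⁻¹)) + t * (A * K) :=
    calc _ = (s * A + t * B) * S ^ α⁻¹ * M ^ (1 - α⁻¹) := by ring
      _ ≤ A * M ^ α⁻¹ * M ^ (1 - α⁻¹) := by gcongr
      _ = A * (s * K' + t * K) := by rw [← hMeq, mul_assoc, hMM]
      _ = s * A * K' + t * (A * K) := by ring
      _ ≤ _ := by gcongr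
  have h2 := (ENNReal.add_le_add_iff_left (by finiteness)).1 h1
  have h3 := (ENNReal.mul_le_mul_iff_right ht0 ht).1 h2
  calc _ = s ^ (α - 1) * ((S ^ α⁻¹ * S ^ (1 - α⁻¹)) * B) := by rw [hSS]
    _ = B * (S ^ α⁻¹ * (s ^ (α - 1) * S ^ (1 - α⁻¹))) := by ring
    _ ≤ B * (S ^ α⁻¹ * M ^ (1 - α⁻¹)) := by gcongr
    _ ≤ A * K := h3

/-- Weights `t n = 1 / (n + 2)` and `s n = 1 - t n`. -/
lemma exists_weights : ∃ s t : ℕ → ℝ≥0∞, (∀ n, s n + t n = 1 ∧ s n ≠ 0 ∧ t n ≠ 0) ∧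
    Tendsto s atTop (𝓝 1) ∧ Tendsto t atTop (𝓝 0) := by
  have hlt : ∀ n : ℕ, ((n + 2 : ℕ) : ℝ≥0∞)⁻¹ < 1 := fun n => by
    rw [ENNReal.inv_lt_one]
    exact_mod_cast (by omega : 1 < n + 2)
  have ht : Tendsto (fun n : ℕ => ((n + 2 : ℕ) : ℝ≥0∞)⁻¹) atTop (𝓝 0) :=
    ENNReal.tendsto_inv_nat_nhds_zero.comp (tendsto_add_atTop_nat 2)
  refine ⟨fun n => 1 - ((n + 2 : ℕ) : ℝ≥0∞)⁻¹, fun n => ((n + 2 : ℕ) : ℝ≥0∞)⁻¹, fun n =>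
    ⟨tsub_add_cancel_of_le (hlt n).le, (tsub_pos_of_lt (hlt n)).ne', ?_⟩, ?_, ht⟩
  · exact ENNReal.inv_ne_zero.2 (ENNReal.natCast_ne_top _)
  · simpa using ENNReal.Tendsto.sub (tendsto_const_nhds (x := (1 : ℝ≥0∞))) ht
      (.inl ENNReal.one_ne_top)

lemma tendsto_mul_mix_rpow {s t : ℕ → ℝ≥0∞} (hs : Tendsto s atTop (𝓝 1))
    (ht : Tendsto t atTop (𝓝 0)) {a b : ℝ≥0∞} (ha : a ≠ ⊤) :
    Tendsto (fun n => a * (s n * b + t n * a) ^ (α - 1)) atTop (𝓝 (a * b ^ (α - 1))) := by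
  have h1 : Tendsto (fun n => s n * b + t n * a) atTop (𝓝 b) := by
    have := (ENNReal.Tendsto.mul_const (b := b) hs (.inl one_ne_zero)).add
      (ENNReal.Tendsto.mul_const (b := a) ht (.inr ha))
    simpa using this
  exact ENNReal.Tendsto.const_mul ((ENNReal.continuous_rpow_const.tendsto b).comp h1) (.inr ha)

lemma tendsto_rpow_mul {s : ℕ → ℝ≥0∞} (hs : Tendsto s atTop (𝓝 1)) {K : ℝ≥0∞} :
    Tendsto (fun n => s n ^ (α - 1) * K) atTop (𝓝 K) := by
  have h1 := (ENNReal.continuous_rpow_const (y := α - 1)).tendsto 1 |>.comp hs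
  have := ENNReal.Tendsto.mul_const (b := K) h1 (.inl (by simp))
  simpa using this

/-- The variational inequality at a minimizer of `∫ u w ^ (α - 1) dμ / ‖u‖`, `α < 1`. -/
lemma mul_crossIntegral_le_of_minimal (hα : 0 < α) (hα1 : α < 1) (hum : Measurable u)
    (hvm : Measurable v) (hu : powerIntegral α μ u ≠ ⊤)
    (hv0 : powerIntegral α μ v ≠ 0) (hv : powerIntegral α μ v ≠ ⊤)
    {A B : ℝ≥0∞} (hA0 : A ≠ 0) (hA : A ≠ ⊤)
    (hmin : ∀ s t : ℝ≥0∞, s + t = 1 → A * powerIntegral α μ (fun x => s * v x + t * u x) ^ α⁻¹ ≤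
      (s * A + t * B) * powerIntegral α μ v ^ α⁻¹) :
    A * crossIntegral α μ u v ≤ powerIntegral α μ v * B := by
  obtain ⟨s, t, hst, hs, ht⟩ := exists_weights
  have hut := ae_ne_top_of_powerIntegral_ne_top hα hum hu
  have hK : ∀ n, crossIntegral α μ u (fun x => s n * v x + t n * u x) ≤
      s n ^ (α - 1) * (powerIntegral α μ v * B / A) := fun n => by
    rw [← mul_div_assoc, ENNReal.le_div_iff_mul_le (.inl hA0) (.inl hA), mul_comm]
    exact mul_crossIntegral_mix_le hα hα1 hum hvm hu hv0 hv (hst n).1 (hst n).2.1 (hst n).2.2 hA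
      (hmin _ _ (hst n).1)
  rw [mul_comm, ← ENNReal.le_div_iff_mul_le (.inl hA0) (.inl hA)]
  -- Fatou is enough for this direction; v may vanish, where m^(α-1) blows up as t → 0.
  calc crossIntegral α μ u v
      = ∫⁻ x, liminf (fun n => u x * (s n * v x + t n * u x) ^ (α - 1)) atTop ∂μ := by
        refine lintegral_congr_ae ?_
        filter_upwards [hut] with x hx using (tendsto_mul_mix_rpow hs ht hx).liminf_eq.symm
    _ ≤ liminf (fun n => crossIntegral α μ u (fun x => s n * v x + t n * u x)) atTop :=
        lintegral_liminf_le fun n => by fun_prop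
    _ ≤ liminf (fun n => s n ^ (α - 1) * (powerIntegral α μ v * B / A)) atTop :=
        liminf_le_liminf (.of_forall hK)
    _ = _ := (tendsto_rpow_mul hs).liminf_eq

/-- The variational inequality at a maximizer of `∫ u w ^ (α - 1) dμ / ‖u‖`, `α > 1`. -/
lemma le_mul_crossIntegral_of_maximal (hα1 : 1 < α) (hum : Measurable u)
    (hvm : Measurable v) (hu : powerIntegral α μ u ≠ ⊤)
    (hv0 : powerIntegral α μ v ≠ 0) (hv : powerIntegral α μ v ≠ ⊤)
    {A B : ℝ≥0∞} (hA0 : A ≠ 0) (hA : A ≠ ⊤)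
    (hmin : ∀ s t : ℝ≥0∞, s + t = 1 → (s * A + t * B) * powerIntegral α μ v ^ α⁻¹ ≤
      A * powerIntegral α μ (fun x => s * v x + t * u x) ^ α⁻¹) :
    powerIntegral α μ v * B ≤ A * crossIntegral α μ u v := by
  have hα : 0 < α := by linarith
  obtain ⟨s, t, hst, hs, ht⟩ := exists_weights
  have hut := ae_ne_top_of_powerIntegral_ne_top hα hum hu
  have hK : ∀ n, s n ^ (α - 1) * (powerIntegral α μ v * B / A) ≤
      crossIntegral α μ u (fun x => s n * v x + t n * u x) := fun n => by
    rw [← mul_div_assoc, ENNReal.div_le_iff hA0 hA, mul_comm _ A]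
    exact le_mul_crossIntegral_mix hα1 hum hvm hu hv0 hv (hst n).1 (hst n).2.1 (hst n).2.2 hA
      (hmin _ _ (hst n).1)
  rw [mul_comm A, ← ENNReal.div_le_iff hA0 hA]
  refine le_of_tendsto_of_tendsto' (tendsto_rpow_mul hs) ?_ hK
  -- For α > 1, m ≤ v + u gives u m^(α-1) ≤ (v + u)^α, an integrable bound independent of n.
  refine tendsto_lintegral_of_dominated_convergence (fun x => (v x + u x) ^ α)
    (fun n => by fun_prop) (fun n => ?_) (powerIntegral_add_ne_top hα hvm hu hv) ?_
  · have hvt := ae_ne_top_of_powerIntegral_ne_top hα hvm hv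
    filter_upwards [hut, hvt] with x h1 h2
    rw [← mul_rpow_sub_one hα (ENNReal.add_ne_top.2 ⟨h2, h1⟩)]
    exact mul_le_mul' le_add_self
      (ENNReal.rpow_le_rpow (mix_le_add (hst n).1 _ _) (by linarith))
  · filter_upwards [hut] with x hx using tendsto_mul_mix_rpow hs ht hx

end

/-! ### Duality between L¹ and bounded functions, and closures of subspaces -/

section

variable {X : Type*} [MeasurableSpace X]

/-- The functional `u ↦ ∫ h u dQ` on `L¹(Q)`, for bounded `h`. -/
noncomputable def integralMulCLM (Q : Measure X) (h : X → ℝ) (hm : Measurable h) (C : ℝ)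
    (hC : ∀ x, ‖h x‖ ≤ C) : Lp ℝ 1 Q →L[ℝ] ℝ :=
  LinearMap.mkContinuous
    { toFun := fun u => ∫ x, h x * u x ∂Q
      map_add' := fun u v => by
        rw [← integral_add ((L1.integrable_coeFn u).bdd_mul hm.aestronglyMeasurable (.of_forall hC))
          ((L1.integrable_coeFn v).bdd_mul hm.aestronglyMeasurable (.of_forall hC))]
        refine integral_congr_ae ?_
        filter_upwards [Lp.coeFn_add u v] with x hx
        rw [hx, Pi.add_apply, mul_add]
      map_smul' := fun a u => by
        rw [RingHom.id_apply, smul_eq_mul, ← integral_const_mul]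
        refine integral_congr_ae ?_
        filter_upwards [Lp.coeFn_smul a u] with x hx
        rw [hx, Pi.smul_apply, smul_eq_mul]
        ring }
    C fun u => by
      change ‖∫ x, h x * u x ∂Q‖ ≤ C * ‖u‖
      rw [L1.norm_eq_integral_norm, ← integral_const_mul]
      refine (norm_integral_le_integral_norm _).trans (integral_mono_of_nonneg
        (.of_forall fun x => norm_nonneg _) ((L1.integrable_coeFn u).norm.const_mul C)
        (.of_forall fun x => ?_))
      simp only [norm_mul]
      exact mul_le_mul_of_nonneg_right (hC x) (norm_nonneg _)

lemma integralMulCLM_apply (Q : Measure X) (h : X → ℝ) (hm : Measurable h) (C : ℝ)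
    (hC : ∀ x, ‖h x‖ ≤ C) (u : Lp ℝ 1 Q) :
    integralMulCLM Q h hm C hC u = ∫ x, h x * u x ∂Q := rfl

/-- The inclusion of `L²` in `L¹` for a probability measure. -/
noncomputable def inclusionL2L1 (Q : Measure X) [IsProbabilityMeasure Q] :
    Lp ℝ 2 Q →L[ℝ] Lp ℝ 1 Q :=
  LinearMap.mkContinuous
    { toFun := fun u => ((Lp.memLp u).mono_exponent one_le_two).toLp u
      map_add' := fun u v => by
        rw [← MemLp.toLp_add]
        exact MemLp.toLp_congr _ _ (Lp.coeFn_add u v)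
      map_smul' := fun a u => by
        rw [RingHom.id_apply, ← MemLp.toLp_const_smul]
        exact MemLp.toLp_congr _ _ (Lp.coeFn_smul a u) }
    1 fun u => by
      change ‖((Lp.memLp u).mono_exponent one_le_two).toLp u‖ ≤ 1 * ‖u‖
      rw [one_mul, Lp.norm_toLp, Lp.norm_def]
      exact ENNReal.toReal_mono (Lp.eLpNorm_ne_top u)
        (eLpNorm_le_eLpNorm_of_exponent_le one_le_two (Lp.aestronglyMeasurable u))

lemma inclusionL2L1_indicatorConstLp (Q : Measure X) [IsProbabilityMeasure Q] {s : Set X}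
    (hs : MeasurableSet s) (c : ℝ) :
    inclusionL2L1 Q (indicatorConstLp 2 hs (measure_ne_top Q s) c) =
      indicatorConstLp 1 hs (measure_ne_top Q s) c :=
  MemLp.toLp_congr ((Lp.memLp _).mono_exponent one_le_two) _ indicatorConstLp_coeFn

/-- Continuous functionals on `L¹` of a probability measure are given by bounded functions. -/
lemma exists_bounded_representative (Q : Measure X) [IsProbabilityMeasure Q]
    (φ : Lp ℝ 1 Q →L[ℝ] ℝ) :
    ∃ (h : X → ℝ) (hm : Measurable h) (C : ℝ) (hC : ∀ x, ‖h x‖ ≤ C),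
      φ = integralMulCLM Q h hm C hC := by
  -- Riesz representation on L² ⊂ L¹. Testing on indicators gives |∫_s h₀| ≤ ‖φ‖ Q(s), hence |h₀| ≤
  -- ‖φ‖ a.e.; density of simple functions carries the formula to all of L¹.
  let h₀ : Lp ℝ 2 Q := (InnerProductSpace.toDual ℝ (Lp ℝ 2 Q)).symm (φ.comp (inclusionL2L1 Q))
  have hrep : ∀ {s : Set X} (hs : MeasurableSet s) (c : ℝ),
      φ (indicatorConstLp 1 hs (measure_ne_top Q s) c) = c * ∫ x in s, h₀ x ∂Q := fun {s} hs c => by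
    rw [← inclusionL2L1_indicatorConstLp, ← ContinuousLinearMap.comp_apply,
      ← InnerProductSpace.toDual_symm_apply (𝕜 := ℝ), real_inner_comm,
      L2.inner_indicatorConstLp_eq_inner_setIntegral]
    simp [h₀, mul_comm]
  have hh₀ : Integrable h₀ Q := (Lp.memLp h₀).integrable one_le_two
  have hle : ∀ {s : Set X}, MeasurableSet s → |∫ x in s, h₀ x ∂Q| ≤ ∫ x in s, ‖φ‖ ∂Q :=
    fun {s} hs => by
      have h1 := φ.le_opNorm (indicatorConstLp 1 hs (measure_ne_top Q s) (1 : ℝ))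
      rw [hrep hs, one_mul, norm_indicatorConstLp one_ne_zero ENNReal.one_ne_top] at h1
      simpa [mul_comm, Measure.real] using h1
  have hub : ∀ᵐ x ∂Q, h₀ x ≤ ‖φ‖ :=
    ae_le_of_forall_setIntegral_le hh₀ (integrable_const _)
      fun s hs _ => (le_abs_self _).trans (hle hs)
  have hlb : ∀ᵐ x ∂Q, -‖φ‖ ≤ h₀ x :=
    ae_le_of_forall_setIntegral_le (integrable_const _) hh₀ fun s hs _ => by
      rw [integral_neg]
      exact neg_le.1 ((neg_le_abs _).trans (hle hs))
  have hm₀ := (Lp.stronglyMeasurable h₀).measurable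
  refine ⟨fun x => max (-‖φ‖) (min (h₀ x) ‖φ‖), by fun_prop, ‖φ‖, fun x => ?_, ?_⟩
  · rw [Real.norm_eq_abs, abs_le]
    exact ⟨le_max_left _ _, max_le (neg_le_self (norm_nonneg _)) (min_le_right _ _)⟩
  · have heq : (fun x => max (-‖φ‖) (min (h₀ x) ‖φ‖)) =ᵐ[Q] h₀ := by
      filter_upwards [hub, hlb] with x h1 h2
      rw [min_eq_left h1, max_eq_right h2]
    ext u
    refine Lp.induction (p := 1) ENNReal.one_ne_top
      (motive := fun u => φ u = integralMulCLM Q _ _ _ _ u) (fun c s hs hQs => ?_)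
      (fun f g hf hg _ h1 h2 => by rw [map_add, map_add, h1, h2])
      (isClosed_eq φ.continuous (ContinuousLinearMap.continuous _)) u
    rw [Lp.simpleFunc.coe_indicatorConst, hrep hs, integralMulCLM_apply, ← integral_const_mul,
      ← integral_indicator hs]
    refine integral_congr_ae ?_
    filter_upwards [heq, indicatorConstLp_coeFn (p := 1) (hs := hs) (hμs := hQs.ne) (c := c)]
      with x h1 h2
    rw [h1, h2]
    by_cases hx : x ∈ s <;> simp [hx, mul_comm]

/-- A function annihilated by every bounded function that annihilates a subspace of `L¹` lies in
the closure of the subspace. -/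
lemma exists_eLpNorm_sub_lt (Q : Measure X) [IsProbabilityMeasure Q] (V : Submodule ℝ (X → ℝ))
    (hV : ∀ v ∈ V, Integrable v Q) {g : X → ℝ} (hg : Integrable g Q)
    (hann : ∀ h : X → ℝ, Measurable h → (∃ C, ∀ x, ‖h x‖ ≤ C) →
      (∀ v ∈ V, ∫ x, h x * v x ∂Q = 0) → ∫ x, h x * g x ∂Q = 0)
    {ε : ℝ≥0∞} (hε : 0 < ε) : ∃ v ∈ V, eLpNorm (g - v) 1 Q < ε := by
  let W : Submodule ℝ (Lp ℝ 1 Q) :=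
    { carrier := {u | ∃ v ∈ V, u =ᵐ[Q] v}
      add_mem' := by
        rintro a b ⟨v, hv, hav⟩ ⟨w, hw, hbw⟩
        exact ⟨v + w, V.add_mem hv hw, (Lp.coeFn_add a b).trans (hav.add hbw)⟩
      zero_mem' := ⟨0, V.zero_mem, Lp.coeFn_zero _ _ _⟩
      smul_mem' := by
        rintro c a ⟨v, hv, hav⟩
        exact ⟨c • v, V.smul_mem c hv, (Lp.coeFn_smul c a).trans (hav.const_smul c)⟩ }
  have hmem : hg.toL1 g ∈ closure (W : Set (Lp ℝ 1 Q)) := by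
    by_contra hnot
    obtain ⟨φ, a, ha, hag⟩ := geometric_hahn_banach_closed_point
      (W.convex.closure) isClosed_closure hnot
    have ha0 : 0 < a := by simpa using ha 0 (subset_closure W.zero_mem)
    have hφW : ∀ u ∈ W, φ u = 0 := by
      intro u hu
      by_contra hne
      -- If φ u ≠ 0, this multiple of u takes the value a exactly, against the strict bound: a
      -- functional bounded above on a subspace vanishes there.
      have := ha ((a / φ u) • u) (subset_closure (W.smul_mem _ hu))
      rw [map_smul, smul_eq_mul, div_mul_cancel₀ _ hne] at this
      exact this.false
    obtain ⟨h, hm, C, hC, rfl⟩ := exists_bounded_representative Q φ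
    have h0 := hann h hm ⟨C, hC⟩ fun v hv => by
      have := hφW ((hV v hv).toL1 v) ⟨v, hv, (hV v hv).coeFn_toL1⟩
      rw [integralMulCLM_apply] at this
      rw [← this]
      refine integral_congr_ae ?_
      filter_upwards [(hV v hv).coeFn_toL1] with x hx
      rw [hx]
    have h1 : integralMulCLM Q h hm C hC (hg.toL1 g) = 0 := by
      rw [integralMulCLM_apply, ← h0]
      refine integral_congr_ae ?_
      filter_upwards [hg.coeFn_toL1] with x hx
      rw [hx]
    linarith
  obtain ⟨u, ⟨v, hv, huv⟩, hlt⟩ := EMetric.mem_closure_iff.1 hmem ε hε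
  refine ⟨v, hv, ?_⟩
  rw [Lp.edist_def] at hlt
  refine lt_of_eq_of_lt (eLpNorm_congr_ae ?_) hlt
  exact hg.coeFn_toL1.symm.sub huv.symm

end

/-! ### Necessary conditions at a forward projection -/

section

variable {X : Type*} [MeasurableSpace X] {α : ℝ} {μ P Q R : Measure X}

lemma crossIntegral_congr_left {u u' v : X → ℝ≥0∞} (h : u =ᵐ[μ] u') :
    crossIntegral α μ u v = crossIntegral α μ u' v :=
  lintegral_congr_ae (h.mono fun x hx => by simp only [hx])

lemma powerIntegral_congr {u u' : X → ℝ≥0∞} (h : u =ᵐ[μ] u') :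
    powerIntegral α μ u = powerIntegral α μ u' :=
  lintegral_congr_ae (h.mono fun x hx => by simp only [hx])

lemma rnDeriv_mix [SigmaFinite μ] [IsFiniteMeasure P] [IsFiniteMeasure Q] {s t : ℝ≥0∞}
    (hs : s ≠ ⊤) (ht : t ≠ ⊤) :
    (s • Q + t • P).rnDeriv μ =ᵐ[μ] fun x => s * Q.rnDeriv μ x + t * P.rnDeriv μ x := by
  have := Measure.smul_finite Q hs
  have := Measure.smul_finite P ht
  filter_upwards [Measure.rnDeriv_add' (s • Q) (t • P) μ,
    Measure.rnDeriv_smul_left_of_ne_top' Q μ hs, Measure.rnDeriv_smul_left_of_ne_top' P μ ht]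
    with x h1 h2 h3
  rw [h1, Pi.add_apply, h2, h3]
  rfl

/-- Linear families are convex. -/
lemma mix_mem_linearFamily [SigmaFinite μ] (hα : 0 < α) {Γ : Type*} {f : Γ → X → ℝ}
    (hQ : Q ∈ linearFamily α μ f) (hP : P ∈ linearFamily α μ f) {s t : ℝ≥0∞} (hst : s + t = 1) :
    s • Q + t • P ∈ linearFamily α μ f := by
  have := hQ.1.isProb
  have := hP.1.isProb
  have hs : s ≠ ⊤ := ne_top_of_le_ne_top ENNReal.one_ne_top (hst ▸ le_self_add)
  have ht : t ≠ ⊤ := ne_top_of_le_ne_top ENNReal.one_ne_top (hst ▸ le_add_self)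
  refine ⟨⟨⟨by simp [hst]⟩, ?_, ?_⟩, fun γ => ⟨?_, ?_⟩⟩
  · refine Measure.AbsolutelyContinuous.add_left ?_ ?_
    · exact (Measure.smul_absolutelyContinuous).trans hQ.1.absCont
    · exact (Measure.smul_absolutelyContinuous).trans hP.1.absCont
  · have h1 := powerIntegral_mix_ne_top hα (Measure.measurable_rnDeriv Q μ)
      hP.1.powerIntegral_ne_top hQ.1.powerIntegral_ne_top hst
    rw [← powerIntegral_congr (rnDeriv_mix hs ht)] at h1
    exact h1.lt_top
  · exact ((hQ.2 γ).1.smul_measure hs).add_measure ((hP.2 γ).1.smul_measure ht)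
  · rw [integral_add_measure ((hQ.2 γ).1.smul_measure hs) ((hP.2 γ).1.smul_measure ht),
      integral_smul_measure, integral_smul_measure, (hQ.2 γ).2, (hP.2 γ).2]
    simp

lemma crossIntegral_mix_rnDeriv [SigmaFinite μ] [IsFiniteMeasure P] [IsFiniteMeasure Q]
    {s t : ℝ≥0∞} (hst : s + t = 1) :
    crossIntegral α μ ((s • Q + t • P).rnDeriv μ) (R.rnDeriv μ) =
      s * crossIntegral α μ (Q.rnDeriv μ) (R.rnDeriv μ) +
        t * crossIntegral α μ (P.rnDeriv μ) (R.rnDeriv μ) := by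
  have hs : s ≠ ⊤ := ne_top_of_le_ne_top ENNReal.one_ne_top (hst ▸ le_self_add)
  have ht : t ≠ ⊤ := ne_top_of_le_ne_top ENNReal.one_ne_top (hst ▸ le_add_self)
  rw [crossIntegral_congr_left (rnDeriv_mix hs ht), crossIntegral_mix_left (by fun_prop)
    (by fun_prop) (by fun_prop)]

lemma powerIntegral_mix_rnDeriv [SigmaFinite μ] [IsFiniteMeasure P] [IsFiniteMeasure Q]
    {s t : ℝ≥0∞} (hst : s + t = 1) :
    powerIntegral α μ ((s • Q + t • P).rnDeriv μ) =
      powerIntegral α μ (fun x => s * Q.rnDeriv μ x + t * P.rnDeriv μ x) := by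
  have hs : s ≠ ⊤ := ne_top_of_le_ne_top ENNReal.one_ne_top (hst ▸ le_self_add)
  have ht : t ≠ ⊤ := ne_top_of_le_ne_top ENNReal.one_ne_top (hst ▸ le_add_self)
  exact powerIntegral_congr (rnDeriv_mix hs ht)

lemma IsForwardProjection.relEntropy_le {E : Set (Measure X)} (h : IsForwardProjection α μ E R Q)
    (hP : P ∈ E) : relEntropy α μ Q R ≤ relEntropy α μ P R :=
  h.eq_iInf ▸ iInf₂_le P hP

lemma IsForwardProjection.relEntropy_lt_top {E : Set (Measure X)}
    (h : IsForwardProjection α μ E R Q) : relEntropy α μ Q R < ⊤ := by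
  obtain ⟨P, hP, hlt⟩ := h.exists_finite
  exact (h.relEntropy_le hP).trans_lt hlt

/-- Finite entropy gives one bound and Hölder the other; their roles swap at α = 1. -/
lemma IsForwardProjection.crossIntegral_ne [SigmaFinite μ] (hα : 0 < α) (hα1 : α ≠ 1) {Γ : Type*}
    {f : Γ → X → ℝ} (hR : IsAdmissible α μ R)
    (h : IsForwardProjection α μ (linearFamily α μ f) R Q) :
    crossIntegral α μ (Q.rnDeriv μ) (R.rnDeriv μ) ≠ 0 ∧
      crossIntegral α μ (Q.rnDeriv μ) (R.rnDeriv μ) ≠ ⊤ := by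
  have hQ := h.mem.1
  have hlt := h.relEntropy_lt_top
  have hQ0 := hQ.powerIntegral_ne_zero hα
  have hR0 := hR.powerIntegral_ne_zero hα
  rcases hα1.lt_or_gt with h1 | h1
  · refine ⟨fun h0 => ?_, (relEntropy_lt_top_iff_of_lt_one hα h1 hQ hR).1 hlt⟩
    have := le_crossIntegral_of_lt_one hα h1 (Measure.measurable_rnDeriv Q μ)
      (Measure.measurable_rnDeriv R μ) hQ0 hQ.powerIntegral_ne_top hR0 hR.powerIntegral_ne_top
    rw [h0, nonpos_iff_eq_zero, mul_eq_zero] at this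
    exact this.elim (by simp [hQ0, hQ.powerIntegral_ne_top])
      (by simp [hR0, hR.powerIntegral_ne_top])
  · exact ⟨(relEntropy_lt_top_iff_of_one_lt h1 hQ hR).1 hlt, crossIntegral_ne_top_of_one_lt h1 hQ hR⟩

/-- Comparison of Q with sQ + tP as t → 0. Finiteness is not assumed: the inequality itself later
shows that ∫ p q^(α-1) dμ is finite. -/
lemma IsForwardProjection.mul_crossIntegral_le [SigmaFinite μ] (hα : 0 < α) (hα1 : α < 1)
    {Γ : Type*} {f : Γ → X → ℝ} (hR : IsAdmissible α μ R)
    (h : IsForwardProjection α μ (linearFamily α μ f) R Q) (hP : P ∈ linearFamily α μ f) :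
    crossIntegral α μ (Q.rnDeriv μ) (R.rnDeriv μ) * crossIntegral α μ (P.rnDeriv μ) (Q.rnDeriv μ) ≤
      powerIntegral α μ (Q.rnDeriv μ) * crossIntegral α μ (P.rnDeriv μ) (R.rnDeriv μ) := by
  have := h.mem.1.isProb
  have := hP.1.isProb
  obtain ⟨hA0, hA⟩ := h.crossIntegral_ne hα hα1.ne hR
  refine mul_crossIntegral_le_of_minimal hα hα1 (by fun_prop) (by fun_prop)
    hP.1.powerIntegral_ne_top (h.mem.1.powerIntegral_ne_zero hα) h.mem.1.powerIntegral_ne_top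
    hA0 hA fun s t hst => ?_
  have hm := mix_mem_linearFamily hα h.mem hP hst
  rw [← powerIntegral_mix_rnDeriv hst, ← crossIntegral_mix_rnDeriv hst]
  exact (relEntropy_le_iff_of_lt_one hα hα1 h.mem.1 hm.1 hR).1 (h.relEntropy_le hm)

lemma IsForwardProjection.le_mul_crossIntegral [SigmaFinite μ] (hα1 : 1 < α)
    {Γ : Type*} {f : Γ → X → ℝ} (hR : IsAdmissible α μ R)
    (h : IsForwardProjection α μ (linearFamily α μ f) R Q) (hP : P ∈ linearFamily α μ f) :
    powerIntegral α μ (Q.rnDeriv μ) * crossIntegral α μ (P.rnDeriv μ) (R.rnDeriv μ) ≤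
    crossIntegral α μ (Q.rnDeriv μ) (R.rnDeriv μ) *
      crossIntegral α μ (P.rnDeriv μ) (Q.rnDeriv μ) := by
  have hα : 0 < α := by linarith
  have := h.mem.1.isProb
  have := hP.1.isProb
  obtain ⟨hA0, hA⟩ := h.crossIntegral_ne hα hα1.ne' hR
  refine le_mul_crossIntegral_of_maximal hα1 (by fun_prop) (by fun_prop)
    hP.1.powerIntegral_ne_top (h.mem.1.powerIntegral_ne_zero hα) h.mem.1.powerIntegral_ne_top
    hA0 hA fun s t hst => ?_
  have hm := mix_mem_linearFamily hα h.mem hP hst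
  rw [← powerIntegral_mix_rnDeriv hst, ← crossIntegral_mix_rnDeriv hst]
  exact (relEntropy_le_iff_of_one_lt hα1 h.mem.1 hm.1 hR).1 (h.relEntropy_le hm)

/-- The constant `∫ q ^ α dμ / ∫ q r ^ (α - 1) dμ` of the power law. -/
noncomputable def powerLawConst (α : ℝ) (μ Q R : Measure X) : ℝ :=
  (powerIntegral α μ (Q.rnDeriv μ) / crossIntegral α μ (Q.rnDeriv μ) (R.rnDeriv μ)).toReal

/-- The function `q ^ (α - 1) - c r ^ (α - 1)`. -/
noncomputable def powerLawFun (α : ℝ) (μ Q R : Measure X) (x : X) : ℝ :=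
  (Q.rnDeriv μ x ^ (α - 1)).toReal -
    powerLawConst α μ Q R * (R.rnDeriv μ x ^ (α - 1)).toReal

/-- Finite cross integrals make both powers finite P-a.e., so `toReal` loses nothing under P. -/
lemma integrable_powerLawFun [SigmaFinite μ] (hP : IsAdmissible α μ P)
    (hC : crossIntegral α μ (P.rnDeriv μ) (Q.rnDeriv μ) ≠ ⊤)
    (hB : crossIntegral α μ (P.rnDeriv μ) (R.rnDeriv μ) ≠ ⊤) :
    Integrable (powerLawFun α μ Q R) P ∧ ∫ x, powerLawFun α μ Q R x ∂P =
      (crossIntegral α μ (P.rnDeriv μ) (Q.rnDeriv μ)).toReal - powerLawConst α μ Q R *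
        (crossIntegral α μ (P.rnDeriv μ) (R.rnDeriv μ)).toReal := by
  rw [crossIntegral_rnDeriv hP (by fun_prop)] at hB hC
  rw [crossIntegral_rnDeriv hP (by fun_prop), crossIntegral_rnDeriv hP (by fun_prop)]
  have hq : Integrable (fun x => (Q.rnDeriv μ x ^ (α - 1)).toReal) P :=
    integrable_toReal_of_lintegral_ne_top (by fun_prop) hC
  have hr : Integrable (fun x => powerLawConst α μ Q R * (R.rnDeriv μ x ^ (α - 1)).toReal) P :=
    (integrable_toReal_of_lintegral_ne_top (by fun_prop) hB).const_mul _
  refine ⟨hq.sub hr, ?_⟩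
  simp only [powerLawFun]
  rw [integral_sub hq hr, integral_const_mul, integral_toReal (by fun_prop)
    (ae_lt_top (by fun_prop) hC), integral_toReal (by fun_prop) (ae_lt_top (by fun_prop) hB)]

/-- Finiteness of the cross integrals with a forward projection. -/
lemma IsForwardProjection.crossIntegral_ne_top [SigmaFinite μ] (hα : 0 < α) (hα1 : α ≠ 1)
    {Γ : Type*} {f : Γ → X → ℝ} (hR : IsAdmissible α μ R)
    (h : IsForwardProjection α μ (linearFamily α μ f) R Q) (hP : P ∈ linearFamily α μ f)
    (hPR : relEntropy α μ P R < ⊤) :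
    crossIntegral α μ (P.rnDeriv μ) (Q.rnDeriv μ) ≠ ⊤ ∧
      crossIntegral α μ (P.rnDeriv μ) (R.rnDeriv μ) ≠ ⊤ := by
  rcases hα1.lt_or_gt with h1 | h1
  · have hB := (relEntropy_lt_top_iff_of_lt_one hα h1 hP.1 hR).1 hPR
    refine ⟨fun htop => ?_, hB⟩
    have hle := h.mul_crossIntegral_le hα h1 hR hP
    rw [htop, ENNReal.mul_top (h.crossIntegral_ne hα hα1 hR).1, top_le_iff] at hle
    exact ENNReal.mul_ne_top h.mem.1.powerIntegral_ne_top hB hle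
  · exact ⟨crossIntegral_ne_top_of_one_lt h1 hP.1 h.mem.1,
      crossIntegral_ne_top_of_one_lt h1 hP.1 hR⟩

lemma IsForwardProjection.integral_powerLawFun [SigmaFinite μ] (hα : 0 < α) (hα1 : α ≠ 1)
    {Γ : Type*} {f : Γ → X → ℝ} (hR : IsAdmissible α μ R)
    (h : IsForwardProjection α μ (linearFamily α μ f) R Q) (hP : P ∈ linearFamily α μ f)
    (hPR : relEntropy α μ P R < ⊤) :
    (α < 1 → ∫ x, powerLawFun α μ Q R x ∂P ≤ 0) ∧
      (1 < α → 0 ≤ ∫ x, powerLawFun α μ Q R x ∂P) := by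
  obtain ⟨hC, hB⟩ := h.crossIntegral_ne_top hα hα1 hR hP hPR
  obtain ⟨hA0, hA⟩ := h.crossIntegral_ne hα hα1 hR
  have hS := h.mem.1.powerIntegral_ne_top
  rw [(integrable_powerLawFun hP.1 hC hB).2, powerLawConst, ENNReal.toReal_div]
  have hApos := ENNReal.toReal_pos hA0 hA
  constructor <;> intro h1
  · have hle := ENNReal.toReal_mono (ENNReal.mul_ne_top hS hB) (h.mul_crossIntegral_le hα h1 hR hP)
    rw [ENNReal.toReal_mul, ENNReal.toReal_mul] at hle
    rw [sub_nonpos, div_mul_eq_mul_div, le_div_iff₀ hApos]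
    linarith
  · have hle := ENNReal.toReal_mono (ENNReal.mul_ne_top hA hC) (h.le_mul_crossIntegral h1 hR hP)
    rw [ENNReal.toReal_mul, ENNReal.toReal_mul] at hle
    rw [sub_nonneg, div_mul_eq_mul_div, div_le_iff₀ hApos]
    linarith

/-- The constant c is exactly the one for which ∫ q^α dμ - c ∫ q r^(α-1) dμ vanishes. -/
lemma IsForwardProjection.integral_self_powerLawFun [SigmaFinite μ] (hα : 0 < α) (hα1 : α ≠ 1)
    {Γ : Type*} {f : Γ → X → ℝ} (hR : IsAdmissible α μ R)
    (h : IsForwardProjection α μ (linearFamily α μ f) R Q) :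
    Integrable (powerLawFun α μ Q R) Q ∧ ∫ x, powerLawFun α μ Q R x ∂Q = 0 := by
  obtain ⟨hA0, hA⟩ := h.crossIntegral_ne hα hα1 hR
  have hCQ := crossIntegral_self hα h.mem.1.ae_rnDeriv_ne_top
  have hg := integrable_powerLawFun h.mem.1 (hCQ ▸ h.mem.1.powerIntegral_ne_top) hA
  refine ⟨hg.1, ?_⟩
  rw [hg.2, hCQ, powerLawConst, ENNReal.toReal_div,
    div_mul_cancel₀ _ (ENNReal.toReal_pos hA0 hA).ne', sub_self]

lemma IsForwardProjection.hasPowerLawForm [SigmaFinite μ] (hα : 0 < α) (hα1 : α ≠ 1)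
    {Γ : Type*} {f : Γ → X → ℝ} (hR : IsAdmissible α μ R)
    (h : IsForwardProjection α μ (linearFamily α μ f) R Q) :
    HasPowerLawForm α μ Q R (powerLawConst α μ Q R) (powerLawFun α μ Q R)
      {x | Q.rnDeriv μ x = 0} := by
  obtain ⟨-, hA⟩ := h.crossIntegral_ne hα hα1 hR
  filter_upwards [h.mem.1.ae_rnDeriv_ne_top, ae_lt_top (by fun_prop) hA] with x hq hqr
  refine ⟨fun hx => ?_, fun hx => hx⟩
  have hq0 : Q.rnDeriv μ x ≠ 0 := hx
  have hqt : Q.rnDeriv μ x ^ (α - 1) ≠ ⊤ := ENNReal.rpow_ne_top_of_ne_zero hq0 hq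
  have hrt : R.rnDeriv μ x ^ (α - 1) ≠ ⊤ := by
    intro hrt
    rw [hrt, ENNReal.mul_top hq0] at hqr
    exact hqr.ne rfl
  unfold powerLawFun
  generalize Q.rnDeriv μ x ^ (α - 1) = a at *
  generalize R.rnDeriv μ x ^ (α - 1) = b at *
  generalize powerLawConst α μ Q R = c at *
  lift a to NNReal using hqt
  lift b to NNReal using hrt
  change ((a : ℝ) : EReal) = (c : EReal) * ((b : ℝ) : EReal) + ((a - c * b : ℝ) : EReal)
  norm_cast
  ring

/-- For α < 1, q^(α-1) = ∞ on {q = 0}, so finiteness of ∫ p q^(α-1) dμ excludes P-mass there. For α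
> 1, g = -c r^(α-1) on that set, and ∫ g dP ≥ 0 rearranges to the claim. -/
lemma IsForwardProjection.sideCondition [SigmaFinite μ] (hα : 0 < α) (hα1 : α ≠ 1)
    {Γ : Type*} {f : Γ → X → ℝ} (hR : IsAdmissible α μ R)
    (h : IsForwardProjection α μ (linearFamily α μ f) R Q) :
    SideCondition α μ (linearFamily α μ f) R (powerLawConst α μ Q R) (powerLawFun α μ Q R)
      {x | Q.rnDeriv μ x = 0} := by
  intro P hP hPR
  obtain ⟨hC, hB⟩ := h.crossIntegral_ne_top hα hα1 hR hP hPR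
  have hgi := (integrable_powerLawFun hP.1 hC hB).1
  have hsign := h.integral_powerLawFun hα hα1 hR hP hPR
  rw [crossIntegral_rnDeriv hP.1 (by fun_prop)] at hC hB
  refine ⟨fun h1 => ?_, fun h1 => ⟨hgi.integrableOn, ?_⟩⟩
  · rw [measure_eq_zero_iff_ae_notMem]
    filter_upwards [ae_lt_top (by fun_prop) hC] with x hx h0
    rw [show Q.rnDeriv μ x = 0 from h0, ENNReal.zero_rpow_of_neg (by linarith)] at hx
    exact hx.ne rfl
  · have hN : MeasurableSet {x | Q.rnDeriv μ x = 0} :=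
      measurableSet_eq_fun (by fun_prop) measurable_const
    have hBN : ∫⁻ x in {x | Q.rnDeriv μ x = 0}, (R.rnDeriv μ x) ^ (α - 1) ∂P ≠ ⊤ :=
      ne_top_of_le_ne_top hB (setLIntegral_le_lintegral _ _)
    have hsplit := integral_add_compl hN hgi
    have hgN : ∫ x in {x | Q.rnDeriv μ x = 0}, powerLawFun α μ Q R x ∂P =
        -(powerLawConst α μ Q R *
          (∫⁻ x in {x | Q.rnDeriv μ x = 0}, (R.rnDeriv μ x) ^ (α - 1) ∂P).toReal) := by
      rw [← integral_toReal (by fun_prop) (ae_restrict_of_ae (ae_lt_top (by fun_prop) hB)),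
        ← integral_const_mul, ← integral_neg]
      refine setIntegral_congr_fun hN fun x hx => ?_
      have hx : Q.rnDeriv μ x = 0 := hx
      simp [powerLawFun, hx, h1]
    rw [← ENNReal.ofReal_toReal hBN, EReal.coe_ennreal_ofReal, max_eq_left ENNReal.toReal_nonneg]
    have : powerLawConst α μ Q R *
        (∫⁻ x in {x | Q.rnDeriv μ x = 0}, (R.rnDeriv μ x) ^ (α - 1) ∂P).toReal ≤
          ∫ x in {x | Q.rnDeriv μ x = 0}ᶜ, powerLawFun α μ Q R x ∂P := by
      linarith [hsign.2 h1]
    exact_mod_cast this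

/-! ### Bounded perturbations of Q and the closed span -/

/-- Perturbing a probability measure by a bounded density `(1 + k) / ∫ (1 + k) dQ`. -/
noncomputable def tilt (Q : Measure X) (k : X → ℝ) : Measure X :=
  Q.withDensity fun x => ENNReal.ofReal ((1 + k x) / ∫ y, (1 + k y) ∂Q)

section Tilt

variable [IsProbabilityMeasure Q] {k : X → ℝ}

lemma integral_one_add_mem (hk : Measurable k) (hk1 : ∀ x, |k x| ≤ 1 / 2) :
    Integrable (fun x => 1 + k x) Q ∧ 1 / 2 ≤ ∫ y, (1 + k y) ∂Q ∧ ∫ y, (1 + k y) ∂Q ≤ 3 / 2 := by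
  have hi : Integrable (fun x => 1 + k x) Q :=
    (integrable_const _).add (.of_bound hk.aestronglyMeasurable (1 / 2) (.of_forall hk1))
  refine ⟨hi, ?_, ?_⟩
  · have := integral_mono (μ := Q) (integrable_const (1 / 2 : ℝ)) hi fun x => by
      linarith [(abs_le.1 (hk1 x)).1]
    simpa using this
  · have := integral_mono (μ := Q) hi (integrable_const (3 / 2 : ℝ)) fun x => by
      linarith [(abs_le.1 (hk1 x)).2]
    simpa using this

/-- Numerator and normalizer both lie in [1/2, 3/2]. -/
lemma tilt_density_mem (hk : Measurable k) (hk1 : ∀ x, |k x| ≤ 1 / 2) (x : X) :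
    1 / 3 ≤ (1 + k x) / ∫ y, (1 + k y) ∂Q ∧ (1 + k x) / ∫ y, (1 + k y) ∂Q ≤ 3 := by
  obtain ⟨-, h1, h2⟩ := integral_one_add_mem (Q := Q) hk hk1
  have h3 := abs_le.1 (hk1 x)
  rw [le_div_iff₀ (by linarith), div_le_iff₀ (by linarith)]
  constructor <;> linarith

lemma isProbabilityMeasure_tilt (hk : Measurable k) (hk1 : ∀ x, |k x| ≤ 1 / 2) :
    IsProbabilityMeasure (tilt Q k) := by
  obtain ⟨hi, h1, h2⟩ := integral_one_add_mem (Q := Q) hk hk1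
  constructor
  rw [tilt, withDensity_apply _ .univ, Measure.restrict_univ,
    ← ofReal_integral_eq_lintegral_ofReal (hi.div_const _)
      (.of_forall fun x => by
        have := (tilt_density_mem (Q := Q) hk hk1 x).1
        simp only [Pi.zero_apply]
        linarith),
    integral_div, div_self (by linarith), ENNReal.ofReal_one]

lemma integral_tilt (hk : Measurable k) (hk1 : ∀ x, |k x| ≤ 1 / 2) {F : X → ℝ}
    (hF : Integrable F Q) :
    Integrable F (tilt Q k) ∧
      ∫ x, F x ∂(tilt Q k) = (∫ x, F x ∂Q + ∫ x, k x * F x ∂Q) / ∫ y, (1 + k y) ∂Q := by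
  have hb := tilt_density_mem (Q := Q) hk hk1
  have hkF : Integrable (fun x => k x * F x) Q :=
    hF.bdd_mul hk.aestronglyMeasurable (.of_forall hk1)
  have heq : (fun x => (ENNReal.ofReal ((1 + k x) / ∫ y, (1 + k y) ∂Q)).toReal • F x) =
      fun x => (F x + k x * F x) / ∫ y, (1 + k y) ∂Q := by
    funext x
    rw [ENNReal.toReal_ofReal (by linarith [(hb x).1]), smul_eq_mul]
    ring
  constructor
  · rw [tilt, integrable_withDensity_iff_integrable_smul' (by fun_prop)
      (.of_forall fun x => ENNReal.ofReal_lt_top), heq]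
    exact (hF.add hkF).div_const _
  · rw [tilt, integral_withDensity_eq_integral_toReal_smul (by fun_prop)
      (.of_forall fun x => ENNReal.ofReal_lt_top), heq, integral_div, integral_add hF hkF]

lemma lintegral_tilt (hk : Measurable k) (hk1 : ∀ x, |k x| ≤ 1 / 2) {F : X → ℝ≥0∞}
    (hF : Measurable F) :
    ENNReal.ofReal (1 / 3) * ∫⁻ x, F x ∂Q ≤ ∫⁻ x, F x ∂(tilt Q k) ∧
      ∫⁻ x, F x ∂(tilt Q k) ≤ ENNReal.ofReal 3 * ∫⁻ x, F x ∂Q := by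
  rw [tilt, lintegral_withDensity_eq_lintegral_mul _ (by fun_prop) hF,
    ← lintegral_const_mul _ hF, ← lintegral_const_mul _ hF]
  have hb := tilt_density_mem (Q := Q) hk hk1
  exact ⟨lintegral_mono fun x => mul_le_mul_left (ENNReal.ofReal_le_ofReal (hb x).1) _,
    lintegral_mono fun x => mul_le_mul_left (ENNReal.ofReal_le_ofReal (hb x).2) _⟩

lemma isAdmissible_tilt [SigmaFinite μ] (hα : 0 < α) (hQ : IsAdmissible α μ Q)
    (hk : Measurable k) (hk1 : ∀ x, |k x| ≤ 1 / 2) : IsAdmissible α μ (tilt Q k) := by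
  refine ⟨isProbabilityMeasure_tilt hk hk1,
    (withDensity_absolutelyContinuous _ _).trans hQ.absCont, ?_⟩
  have hb := tilt_density_mem (Q := Q) hk hk1
  have hd : tilt Q k = μ.withDensity
      (Q.rnDeriv μ * fun x => ENNReal.ofReal ((1 + k x) / ∫ y, (1 + k y) ∂Q)) := by
    rw [withDensity_mul _ (by fun_prop) (by fun_prop), Measure.withDensity_rnDeriv_eq Q μ hQ.absCont]
    rfl
  have hrn := Measure.rnDeriv_withDensity μ (f := Q.rnDeriv μ * fun x =>
    ENNReal.ofReal ((1 + k x) / ∫ y, (1 + k y) ∂Q)) (by fun_prop)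
  rw [← hd] at hrn
  have hle : ∫⁻ x, (tilt Q k).rnDeriv μ x ^ α ∂μ ≤
      ∫⁻ x, ENNReal.ofReal 3 ^ α * Q.rnDeriv μ x ^ α ∂μ := by
    refine lintegral_mono_ae ?_
    filter_upwards [hrn] with x hx
    rw [hx, ← ENNReal.mul_rpow_of_nonneg _ _ hα.le, Pi.mul_apply, mul_comm]
    exact ENNReal.rpow_le_rpow (mul_le_mul_left (ENNReal.ofReal_le_ofReal (hb x).2) _) hα.le
  refine hle.trans_lt ?_
  rw [lintegral_const_mul _ (by fun_prop)]
  exact ENNReal.mul_lt_top (ENNReal.rpow_lt_top_of_nonneg hα.le ENNReal.ofReal_ne_top) hQ.memLalpha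

lemma tilt_mem_linearFamily [SigmaFinite μ] (hα : 0 < α) {Γ : Type*} {f : Γ → X → ℝ}
    (hQ : Q ∈ linearFamily α μ f) (hk : Measurable k) (hk1 : ∀ x, |k x| ≤ 1 / 2)
    (hkf : ∀ γ, ∫ x, k x * f γ x ∂Q = 0) : tilt Q k ∈ linearFamily α μ f := by
  refine ⟨isAdmissible_tilt hα hQ.1 hk hk1, fun γ => ?_⟩
  have := integral_tilt hk hk1 (hQ.2 γ).1
  refine ⟨this.1, ?_⟩
  rw [this.2, (hQ.2 γ).2, hkf γ]
  simp

/-- The upper density bound 3 keeps the cross integral finite for α < 1; the lower bound 1/3 keeps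
it nonzero for α > 1. -/
lemma relEntropy_tilt_lt_top [SigmaFinite μ] (hα : 0 < α) (hα1 : α ≠ 1)
    (hQ : IsAdmissible α μ Q) (hR : IsAdmissible α μ R) (hQR : relEntropy α μ Q R < ⊤)
    (hk : Measurable k) (hk1 : ∀ x, |k x| ≤ 1 / 2) : relEntropy α μ (tilt Q k) R < ⊤ := by
  have hT := isAdmissible_tilt hα hQ hk hk1
  have hb := lintegral_tilt (Q := Q) hk hk1 (F := fun x => R.rnDeriv μ x ^ (α - 1)) (by fun_prop)
  rcases hα1.lt_or_gt with h | h
  · rw [relEntropy_lt_top_iff_of_lt_one hα h hT hR, crossIntegral_rnDeriv hT (by fun_prop)]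
    rw [relEntropy_lt_top_iff_of_lt_one hα h hQ hR, crossIntegral_rnDeriv hQ (by fun_prop)] at hQR
    exact ne_top_of_le_ne_top (ENNReal.mul_ne_top ENNReal.ofReal_ne_top hQR) hb.2
  · rw [relEntropy_lt_top_iff_of_one_lt h hT hR, crossIntegral_rnDeriv hT (by fun_prop)]
    rw [relEntropy_lt_top_iff_of_one_lt h hQ hR, crossIntegral_rnDeriv hQ (by fun_prop)] at hQR
    intro h0
    have h1 := hb.1
    rw [h0, nonpos_iff_eq_zero, mul_eq_zero] at h1
    exact h1.elim (by simp) hQR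

end Tilt

/-- Since ∫ g dQ = 0, the integral of g under the tilted measure is ∫ k g dQ over a positive
normalizer, so it inherits the sign from the variational inequality. -/
lemma IsForwardProjection.integral_mul_powerLawFun_sign [SigmaFinite μ] (hα : 0 < α)
    (hα1 : α ≠ 1) {Γ : Type*} {f : Γ → X → ℝ} (hR : IsAdmissible α μ R)
    (h : IsForwardProjection α μ (linearFamily α μ f) R Q) {k : X → ℝ} (hk : Measurable k)
    (hk1 : ∀ x, |k x| ≤ 1 / 2) (hkf : ∀ γ, ∫ x, k x * f γ x ∂Q = 0) :
    (α < 1 → ∫ x, k x * powerLawFun α μ Q R x ∂Q ≤ 0) ∧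
      (1 < α → 0 ≤ ∫ x, k x * powerLawFun α μ Q R x ∂Q) := by
  have := h.mem.1.isProb
  obtain ⟨hgi, hg0⟩ := h.integral_self_powerLawFun hα hα1 hR
  have hsign := h.integral_powerLawFun hα hα1 hR (tilt_mem_linearFamily hα h.mem hk hk1 hkf)
    (relEntropy_tilt_lt_top hα hα1 h.mem.1 hR h.relEntropy_lt_top hk hk1)
  have hZ : 0 < ∫ y, (1 + k y) ∂Q := by linarith [(integral_one_add_mem (Q := Q) hk hk1).2.1]
  rw [(integral_tilt hk hk1 hgi).2, hg0, zero_add] at hsign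
  refine ⟨fun h1 => ?_, fun h1 => ?_⟩
  · simpa using (div_le_iff₀ hZ).1 (hsign.1 h1)
  · simpa using (le_div_iff₀ hZ).1 (hsign.2 h1)

lemma IsForwardProjection.integral_mul_powerLawFun [SigmaFinite μ] (hα : 0 < α)
    (hα1 : α ≠ 1) {Γ : Type*} {f : Γ → X → ℝ} (hR : IsAdmissible α μ R)
    (h : IsForwardProjection α μ (linearFamily α μ f) R Q) {k : X → ℝ} (hk : Measurable k)
    {C : ℝ} (hC : ∀ x, ‖k x‖ ≤ C) (hkf : ∀ γ, ∫ x, k x * f γ x ∂Q = 0) :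
    ∫ x, k x * powerLawFun α μ Q R x ∂Q = 0 := by
  -- This scale gives |δk| ≤ 1/2 for any bound C; both δk and -δk are then allowed, and the two
  -- signs force equality.
  have hδ : 0 < 1 / (2 * (|C| + 1)) := by positivity
  have hbd : ∀ x, |1 / (2 * (|C| + 1)) * k x| ≤ 1 / 2 := fun x => by
    rw [abs_mul, abs_of_pos hδ, div_mul_eq_mul_div, one_mul, div_le_iff₀ (by positivity)]
    have := (hC x).trans (le_abs_self C)
    rw [Real.norm_eq_abs] at this
    linarith
  generalize 1 / (2 * (|C| + 1)) = δ at hδ hbd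
  have h1 := h.integral_mul_powerLawFun_sign hα hα1 hR (k := fun x => δ * k x) (by fun_prop) hbd
    fun γ => by simp only [mul_assoc]; rw [integral_const_mul, hkf γ, mul_zero]
  have h2 := h.integral_mul_powerLawFun_sign hα hα1 hR (k := fun x => -(δ * k x)) (by fun_prop)
    (fun x => by rw [abs_neg]; exact hbd x)
    fun γ => by
      simp only [neg_mul, mul_assoc]
      rw [integral_neg, integral_const_mul, hkf γ, mul_zero, neg_zero]
  simp only [neg_mul, mul_assoc, integral_neg, integral_const_mul] at h1 h2
  have h3 : δ * ∫ x, k x * powerLawFun α μ Q R x ∂Q = 0 := by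
    rcases hα1.lt_or_gt with hlt | hgt
    · exact le_antisymm (h1.1 hlt) (by linarith [h2.1 hlt])
    · exact le_antisymm (by linarith [h2.2 hgt]) (h1.2 hgt)
  exact (mul_eq_zero.1 h3).resolve_left hδ.ne'

lemma IsForwardProjection.inL1ClosureSpan [SigmaFinite μ] (hα : 0 < α)
    (hα1 : α ≠ 1) {Γ : Type*} {f : Γ → X → ℝ} (hR : IsAdmissible α μ R)
    (h : IsForwardProjection α μ (linearFamily α μ f) R Q) :
    InL1ClosureSpan Q f (powerLawFun α μ Q R) := by
  have := h.mem.1.isProb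
  obtain ⟨hgi, -⟩ := h.integral_self_powerLawFun hα hα1 hR
  refine ⟨memLp_one_iff_integrable.2 hgi, fun ε hε => ?_⟩
  refine exists_eLpNorm_sub_lt Q _ (fun v hv => (integral_span_eq_zero h.mem hv).1) hgi ?_ hε
  rintro k hk ⟨C, hC⟩ hkv
  exact h.integral_mul_powerLawFun hα hα1 hR hk hC
    fun γ => hkv (f γ) (Submodule.subset_span ⟨γ, rfl⟩)

end

end RelAlpha

theorem mainTheorem4 {X : Type*} [MeasurableSpace X] (μ : Measure X) [SigmaFinite μ]
    (α : ℝ) (hα : 0 < α) (hα1 : α ≠ 1)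
    {Γ : Type*} (f : Γ → X → ℝ) (hf : ∀ γ, Measurable (f γ))
    (R : Measure X) (hR : RelAlpha.IsAdmissible α μ R) :
    -- (a)
    (∀ Q : Measure X,
      RelAlpha.IsForwardProjection α μ (RelAlpha.linearFamily α μ f) R Q →
      ∃ (c : ℝ) (g : X → ℝ) (N : Set X),
        MeasurableSet N ∧
        RelAlpha.HasPowerLawForm α μ Q R c g N ∧
        RelAlpha.SideCondition α μ (RelAlpha.linearFamily α μ f) R c g N ∧
        (0 < ∫⁻ x, Q.rnDeriv μ x * (R.rnDeriv μ x) ^ (α - 1) ∂μ ∧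
          ∫⁻ x, Q.rnDeriv μ x * (R.rnDeriv μ x) ^ (α - 1) ∂μ < ⊤ ∧
          c = ((∫⁻ x, (Q.rnDeriv μ x) ^ α ∂μ) /
            ∫⁻ x, Q.rnDeriv μ x * (R.rnDeriv μ x) ^ (α - 1) ∂μ).toReal) ∧
        RelAlpha.InL1ClosureSpan Q f g) ∧
    -- (b)
    (∀ Q ∈ RelAlpha.linearFamily α μ f, ∀ (c : ℝ) (g : X → ℝ) (N : Set X),
      MeasurableSet N →
      g ∈ Submodule.span ℝ (Set.range f) →
      RelAlpha.HasPowerLawForm α μ Q R c g N →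
      RelAlpha.SideCondition α μ (RelAlpha.linearFamily α μ f) R c g N →
      (RelAlpha.IsForwardProjection α μ (RelAlpha.linearFamily α μ f) R Q ∧
        ∀ Q', RelAlpha.IsForwardProjection α μ (RelAlpha.linearFamily α μ f) R Q' → Q' = Q) ∧
      ∀ P ∈ RelAlpha.linearFamily α μ f, RelAlpha.relEntropy α μ P R < ⊤ →
        RelAlpha.relEntropy α μ P Q + RelAlpha.relEntropy α μ Q R ≤ RelAlpha.relEntropy α μ P R ∧
        (α < 1 → RelAlpha.relEntropy α μ P R =
          RelAlpha.relEntropy α μ P Q + RelAlpha.relEntropy α μ Q R)) := by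
  refine ⟨fun Q hQ => ?_, fun Q hQ c g N hN hg hform hside => ?_⟩
  · obtain ⟨hA0, hA⟩ := hQ.crossIntegral_ne hα hα1 hR
    exact ⟨RelAlpha.powerLawConst α μ Q R, RelAlpha.powerLawFun α μ Q R,
      {x | Q.rnDeriv μ x = 0}, measurableSet_eq_fun (by fun_prop) measurable_const,
      hQ.hasPowerLawForm hα hα1 hR, hQ.sideCondition hα hα1 hR,
      ⟨pos_iff_ne_zero.2 hA0, hA.lt_top, rfl⟩, hQ.inL1ClosureSpan hα hα1 hR⟩
  · have hpyth := fun P hP hPR => RelAlpha.pythagorean_of_hasPowerLawForm (P := P) hα hα1 hR hQ hN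
      hg hform hside hP hPR
    exact ⟨RelAlpha.isForwardProjection_of_pythagorean hα hα1 hQ
      (RelAlpha.relEntropy_lt_top_of_hasPowerLawForm hα hα1 hR hQ hg hform) hR
      fun P hP hPR => (hpyth P hP hPR).1, hpyth⟩
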